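/- **Theorem 6.8.** Let $N\ge 0$ and $K\geq 1$ be integers. All $C^*$-algebras and their morphisms are unital. Let $$C(S^{N-1}_{\mathbb C,+})=C^*\Big(z_1,\ldots,z_N\ \Big|\ \sum_i z_iz_i^*=1=\sum_i z_i^*z_i\Big)$$ be the universal $C^*$-algebra of the free complex sphere, and let $X\subset S^{N-1}_{\mathbb C,+}$ be a closed noncommutative subspace, i.e. a $C^*$-algebra $C(X)$ together with a surjective morphism of $C^*$-algebras $C(S^{N-1}_{\mathbb C,+})\to C(X)$; the images of the coordinates are still denoted $z_i$. Assume that $X$ is $K$-symmetric: the action of the group $\mu_K$ of $K$-th roots of unity on $C(S^{N-1}_{\mathbb C,+})$ given by $\omega\cdot z_i=\omega z_i$ induces an action of $\mu_K$ on $C(X)$ by $*$-automorphisms. Let $X_{1/K\text{-class}}\subset X$ be the $1/K$-classical version of $X$ (the intersection of $X$ with the $K$-half-liberated sphere $S^{N-1}_{\mathbb C,K}$), defined by $$C(X_{1/K\text{-class}})=C(X)\Big/\Big\langle [z_{i_1}\cdots z_{i_K},z_{j_1}\cdots z_{j_K}]=0= [z_{i_1}\cdots z_{i_K},z_{j_1}^*\cdots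 z_{j_K}^*]\ \ \forall\, i_1,\ldots,i_K,j_1,\ldots,j_K\Big\rangle,$$ the quotient by the closed two-sided ideal generated by these commutators. Let $X^{(K)}\subset X$ be defined by $C(X^{(K)})=C(X)/J_K$, where $J_K$ is the intersection of the kernels of all representations $C(X)\to M_L(\mathbb C)$ with $L\le K$. Let $S^{N-1}_{\mathbb C}=\{z\in\mathbb C^N : \sum_i|z_i|^2=1\}$. Then there exist a compact subset $T\subset (S^{N-1}_{\mathbb C})^K$ that is symmetric, i.e. stable under cyclic permutation of the $K$ factors, and an injective morphism of $C^*$-algebras (a faithful matrix model) $$C(X_{1/K\text{-class}})\longrightarrow M_K(C(T)).$$ In particular $X_{1/K\text{-class}}\subset X^{(K)}$, that is, the quotient map $C(X)\to C(X_{1/K\text{-class}})$ factorizes through a surjective morphism $C(X^{(K)})\to C(X_{1/K\text{-class}})$. -/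

import Mathlib

noncomputable section

/-- A closed two-sided ideal of a unital C⋆-algebra. -/
structure ClosedIdeal (A : Type*) [CStarAlgebra A] where
  toIdeal : Ideal A
  mul_mem_right : ∀ {x : A} (y : A), x ∈ toIdeal → x * y ∈ toIdeal
  isClosed : IsClosed (toIdeal : Set A)

namespace ClosedIdeal

variable {A : Type*} [CStarAlgebra A]

/-- The closed two-sided ideal generated by a set. -/
def span (S : Set A) : ClosedIdeal A where
  toIdeal := sInf {I : Ideal A | (∀ x ∈ I, ∀ y, x * y ∈ I) ∧ IsClosed (I : Set A) ∧ S ⊆ I}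
  mul_mem_right := by
    intro x y hx
    simp only [Submodule.mem_sInf, Set.mem_ofPred_eq] at hx ⊢
    exact fun I hI => hI.1 x (hx I hI) y
  isClosed := by
    rw [Submodule.coe_sInf]
    exact isClosed_biInter fun I hI => hI.2.1

instance (I : ClosedIdeal A) : I.toIdeal.IsTwoSided := ⟨fun y hx => I.mul_mem_right y hx⟩

instance (I : ClosedIdeal A) : IsClosed (I.toIdeal : Set A) := I.isClosed

/-- Approximate units relative to a single element: if `y⋆y ∈ I`, there are `e ∈ I` with
`1 - e` a selfadjoint contraction and `y (1 - e)` arbitrarily small. -/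
theorem exists_approx (I : ClosedIdeal A) {y : A} (hy : star y * y ∈ I.toIdeal) {ε : ℝ}
    (hε : 0 < ε) : ∃ r : A, IsSelfAdjoint r ∧ ‖r‖ ≤ 1 ∧ 1 - r ∈ I.toIdeal ∧ ‖y * r‖ ≤ ε := by
  set h : A := star y * y with hh
  have hsa : IsSelfAdjoint h := IsSelfAdjoint.star_mul_self y
  set c : ℝ := 1 / (2 * ε ^ 2) with hc
  have hc0 : 0 < c := by positivity
  have hpos : ∀ t : ℝ, 0 < 1 + c ^ 2 * t ^ 2 := fun t => by positivity
  let f : ℝ → ℝ := fun t => (1 + c ^ 2 * t ^ 2)⁻¹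
  have hf : Continuous f :=
    Continuous.inv₀ (by fun_prop) fun t => (hpos t).ne'
  have hf1 : ∀ t, f t ≤ 1 := fun t => by
    apply inv_le_one_of_one_le₀
    nlinarith [mul_nonneg (sq_nonneg c) (sq_nonneg t)]
  have hf0 : ∀ t, 0 < f t := fun t => inv_pos.2 (hpos t)
  have hrsa : IsSelfAdjoint (cfc f h) := cfc_predicate f h
  refine ⟨cfc f h, hrsa, ?_, ?_, ?_⟩
  · refine norm_cfc_le zero_le_one fun t _ => ?_
    rw [Real.norm_eq_abs, abs_of_pos (hf0 t)]
    exact hf1 t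
  · have e : 1 - cfc f h = cfc (fun t => c ^ 2 * t * f t) h * h := by
      have e1 : (1 : A) - cfc f h = cfc (fun t => 1 - f t) h := by
        rw [cfc_sub (fun _ => (1 : ℝ)) f h (by fun_prop) (hf.continuousOn), cfc_const_one ℝ h]
      have e2 : cfc (fun t => c ^ 2 * t * f t) h * h
          = cfc (fun t => (c ^ 2 * t * f t) * t) h := by
        conv_lhs => rw [← cfc_id' ℝ h]
        rw [cfc_id' ℝ h]
        rw [cfc_mul (fun t => c ^ 2 * t * f t) (fun t => t) h
          ((by fun_prop : Continuous _).continuousOn) (by fun_prop), cfc_id' ℝ h]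
      rw [e1, e2]
      refine cfc_congr fun t _ => ?_
      have := (hpos t).ne'
      simp only [f]
      field_simp
      ring
    rw [e]
    exact I.toIdeal.mul_mem_left _ hy
  · have e : star (y * cfc f h) * (y * cfc f h) = cfc (fun t => f t * t * f t) h := by
      rw [star_mul, hrsa.star_eq]
      have : cfc f h * star y * (y * cfc f h) = cfc f h * h * cfc f h := by
        rw [hh]; noncomm_ring
      rw [this, cfc_mul (fun t => f t * t) f h ((by fun_prop : Continuous _).continuousOn)
        hf.continuousOn, cfc_mul f (fun t => t) h hf.continuousOn (by fun_prop), cfc_id' ℝ h]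
    have hb : ‖star (y * cfc f h) * (y * cfc f h)‖ ≤ ε ^ 2 := by
      rw [e]
      refine norm_cfc_le (by positivity) fun t _ => ?_
      rw [Real.norm_eq_abs, abs_mul, abs_mul, abs_of_pos (hf0 t)]
      have h1 : f t * |t| * f t ≤ f t * |t| := by
        have : 0 ≤ f t * |t| := mul_nonneg (hf0 t).le (abs_nonneg t)
        nlinarith [hf1 t]
      refine h1.trans ?_
      simp only [f]
      rw [inv_mul_eq_div, div_le_iff₀ (hpos t)]
      have hce : c * ε ^ 2 = 1 / 2 := by rw [hc]; field_simp
      rw [← sq_abs t]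
      have h2 : ε ^ 2 * (1 + c ^ 2 * |t| ^ 2) - |t| = ε ^ 2 * (1 - c * |t|) ^ 2
          + (2 * (c * ε ^ 2) - 1) * |t| := by ring
      have h3 : 0 ≤ ε ^ 2 * (1 - c * |t|) ^ 2 := by positivity
      rw [hce] at h2
      linarith
    rw [CStarRing.norm_star_mul_self] at hb
    exact abs_le_of_sq_le_sq' (by nlinarith) hε.le |>.2

theorem star_mem (I : ClosedIdeal A) {x : A} (hx : x ∈ I.toIdeal) : star x ∈ I.toIdeal := by
  have hy : star (star x) * star x ∈ I.toIdeal := by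
    rw [star_star]; exact I.mul_mem_right _ hx
  have : star x ∈ closure (I.toIdeal : Set A) := by
    refine Metric.mem_closure_iff.2 fun ε hε => ?_
    obtain ⟨r, -, -, hr, hn⟩ := I.exists_approx hy (half_pos hε)
    refine ⟨star x * (1 - r), I.toIdeal.mul_mem_left _ hr, ?_⟩
    rw [dist_eq_norm, mul_sub, mul_one, sub_sub_cancel]
    linarith
  rwa [I.isClosed.closure_eq] at this

/-- The quotient C⋆-algebra `A ⧸ I`, with the quotient norm. -/
def Quot (I : ClosedIdeal A) : Type _ := A ⧸ I.toIdeal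

variable (I : ClosedIdeal A)

instance : NormedAddCommGroup I.Quot := inferInstanceAs (NormedAddCommGroup (A ⧸ I.toIdeal))

instance : Ring I.Quot := inferInstanceAs (Ring (A ⧸ I.toIdeal))

instance : Algebra ℂ I.Quot := inferInstanceAs (Algebra ℂ (A ⧸ I.toIdeal))

instance : CompleteSpace I.Quot := inferInstanceAs (CompleteSpace (A ⧸ I.toIdeal))

/-- The underlying algebra morphism of the quotient map. -/
def mkAlg : A →ₐ[ℂ] I.Quot := Ideal.Quotient.mkₐ ℂ I.toIdeal

theorem mkAlg_surjective : Function.Surjective I.mkAlg := Ideal.Quotient.mkₐ_surjective ℂ I.toIdeal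

theorem mkAlg_eq_iff {a b : A} : I.mkAlg a = I.mkAlg b ↔ a - b ∈ I.toIdeal :=
  Ideal.Quotient.mk_eq_mk_iff_sub_mem a b

theorem norm_mkAlg_le (a : A) : ‖I.mkAlg a‖ ≤ ‖a‖ := Submodule.Quotient.norm_mk_le I.toIdeal a

theorem exists_norm_lt (x : I.Quot) {ε : ℝ} (hε : 0 < ε) : ∃ a, I.mkAlg a = x ∧ ‖a‖ < ‖x‖ + ε :=
  Submodule.Quotient.norm_mk_lt x hε

instance : NormedRing I.Quot where
  __ := (inferInstance : NormedAddCommGroup I.Quot)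
  __ := (inferInstance : Ring I.Quot)
  norm_mul_le x y := by
    have key : ∀ ε : ℝ, 0 < ε → ‖x * y‖ ≤ (‖x‖ + ε) * (‖y‖ + ε) := by
      intro ε hε
      obtain ⟨a, rfl, ha⟩ := I.exists_norm_lt x hε
      obtain ⟨b, rfl, hb⟩ := I.exists_norm_lt y hε
      rw [← map_mul]
      calc _ ≤ ‖a * b‖ := I.norm_mkAlg_le _
        _ ≤ ‖a‖ * ‖b‖ := norm_mul_le a b
        _ ≤ _ := by gcongr
    have ht : Filter.Tendsto (fun ε : ℝ => (‖x‖ + ε) * (‖y‖ + ε)) (nhdsWithin 0 (Set.Ioi 0))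
        (nhds ((‖x‖ + 0) * (‖y‖ + 0))) :=
      (Continuous.tendsto (by fun_prop) 0).mono_left nhdsWithin_le_nhds
    simp only [add_zero] at ht
    exact ge_of_tendsto ht (Filter.eventually_of_mem self_mem_nhdsWithin fun ε hε => key ε hε)

instance : NormedAlgebra ℂ I.Quot where
  norm_smul_le :=
    (inferInstance : NormedSpace ℂ (A ⧸ I.toIdeal)).norm_smul_le

instance : StarRing I.Quot where
  star := Quotient.map' star fun a b hab => by
    rw [Submodule.quotientRel_def] at hab ⊢
    rw [← star_sub]
    exact I.star_mem hab
  star_involutive x := by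
    obtain ⟨a, rfl⟩ := I.mkAlg_surjective x
    exact congrArg I.mkAlg (star_star a)
  star_mul x y := by
    obtain ⟨a, rfl⟩ := I.mkAlg_surjective x
    obtain ⟨b, rfl⟩ := I.mkAlg_surjective y
    exact congrArg I.mkAlg (star_mul a b)
  star_add x y := by
    obtain ⟨a, rfl⟩ := I.mkAlg_surjective x
    obtain ⟨b, rfl⟩ := I.mkAlg_surjective y
    exact congrArg I.mkAlg (star_add a b)

/-- The quotient map `A → A ⧸ I`, as a morphism of C⋆-algebras. -/
def quotMap : A →⋆ₐ[ℂ] I.Quot where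
  __ := I.mkAlg
  map_star' _ := rfl

theorem quotMap_surjective : Function.Surjective I.quotMap := I.mkAlg_surjective

theorem quotMap_eq_zero_iff {a : A} : I.quotMap a = 0 ↔ a ∈ I.toIdeal := by
  rw [← map_zero I.quotMap]
  exact I.mkAlg_eq_iff.trans (by rw [sub_zero])

instance : CStarAlgebra I.Quot where
  norm_mul_self_le x := by
    obtain ⟨a, rfl⟩ := I.quotMap_surjective x
    rw [← map_star, ← map_mul]
    refine le_of_forall_pos_le_add fun ε hε => ?_
    obtain ⟨b, hb, hbn⟩ := I.exists_norm_lt (I.quotMap (star a * a)) (half_pos hε)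
    have hy : b - star a * a ∈ I.toIdeal := I.mkAlg_eq_iff.1 hb
    obtain ⟨r, hr, hr1, hrI, hrn⟩ :=
      I.exists_approx (I.toIdeal.mul_mem_left (star (b - star a * a)) hy) (half_pos hε)
    have hmk : I.quotMap a = I.quotMap (a * r) := by
      refine I.mkAlg_eq_iff.2 ?_
      have : a - a * r = a * (1 - r) := by noncomm_ring
      rw [this]
      exact I.toIdeal.mul_mem_left _ hrI
    have h1 : ‖I.quotMap a‖ ≤ ‖a * r‖ := by rw [hmk]; exact I.norm_mkAlg_le _
    have h2 : star (a * r) * (a * r) = r * b * r - r * ((b - star a * a) * r) := by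
      rw [star_mul, hr.star_eq]; noncomm_ring
    calc ‖I.quotMap a‖ * ‖I.quotMap a‖ ≤ ‖a * r‖ * ‖a * r‖ := by gcongr
      _ = ‖star (a * r) * (a * r)‖ := CStarRing.norm_star_mul_self.symm
      _ ≤ ‖r * b * r‖ + ‖r * ((b - star a * a) * r)‖ := by rw [h2]; exact norm_sub_le _ _
      _ ≤ 1 * ‖b‖ * 1 + 1 * (ε / 2) := by
          gcongr
          · refine (norm_mul_le _ _).trans ?_
            gcongr
            refine (norm_mul_le _ _).trans ?_
            gcongr
          · refine (norm_mul_le _ _).trans ?_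
            gcongr
      _ ≤ ‖I.quotMap (star a * a)‖ + ε := by linarith
  star_smul c x := by
    obtain ⟨a, rfl⟩ := I.quotMap_surjective x
    rw [← map_smul, ← map_star, star_smul, map_smul, map_star]

end ClosedIdeal


/-- The algebra `ℂ⟨z₁, …, z_N, z₁⋆, …, z_N⋆⟩` of noncommutative polynomials: the letter `(i, false)`
is `z_i` and the letter `(i, true)` is `z_i⋆`. -/
def StarPoly (N : ℕ) : Type := FreeAlgebra ℂ (Fin N × Bool)

namespace StarPoly

variable {N : ℕ}

instance : Ring (StarPoly N) := inferInstanceAs (Ring (FreeAlgebra ℂ (Fin N × Bool)))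

instance : Algebra ℂ (StarPoly N) := inferInstanceAs (Algebra ℂ (FreeAlgebra ℂ (Fin N × Bool)))

/-- The letters. -/
def letter (x : Fin N × Bool) : StarPoly N := FreeAlgebra.ι ℂ x

theorem induct {p : StarPoly N → Prop} (h1 : ∀ r : ℂ, p (algebraMap ℂ _ r))
    (h2 : ∀ x, p (letter x)) (h3 : ∀ a b, p a → p b → p (a * b))
    (h4 : ∀ a b, p a → p b → p (a + b)) (a : StarPoly N) : p a :=
  FreeAlgebra.induction ℂ (Fin N × Bool) h1 h2 h3 h4 a

/-- The ring morphism to the opposite ring underlying the involution. -/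
def starHom (N : ℕ) : StarPoly N →+* (StarPoly N)ᵐᵒᵖ :=
  letI : Algebra ℂ (StarPoly N)ᵐᵒᵖ :=
    ((algebraMap ℂ (StarPoly N)ᵐᵒᵖ).comp (starRingEnd ℂ)).toAlgebra' fun c x => by
      simpa using Algebra.commutes (starRingEnd ℂ c) x
  (FreeAlgebra.lift ℂ fun x : Fin N × Bool =>
    MulOpposite.op (letter (x.1, !x.2))).toRingHom

theorem starHom_algebraMap (c : ℂ) : starHom N (algebraMap ℂ _ c) =
    MulOpposite.op (algebraMap ℂ (StarPoly N) (starRingEnd ℂ c)) :=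
  letI : Algebra ℂ (StarPoly N)ᵐᵒᵖ :=
    ((algebraMap ℂ (StarPoly N)ᵐᵒᵖ).comp (starRingEnd ℂ)).toAlgebra' fun c x => by
      simpa using Algebra.commutes (starRingEnd ℂ c) x
  (FreeAlgebra.lift ℂ fun x : Fin N × Bool =>
    MulOpposite.op (letter (x.1, !x.2))).commutes c

theorem starHom_letter (x : Fin N × Bool) : starHom N (letter x) =
    MulOpposite.op (letter (x.1, !x.2)) :=
  letI : Algebra ℂ (StarPoly N)ᵐᵒᵖ :=
    ((algebraMap ℂ (StarPoly N)ᵐᵒᵖ).comp (starRingEnd ℂ)).toAlgebra' fun c x => by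
      simpa using Algebra.commutes (starRingEnd ℂ c) x
  FreeAlgebra.lift_ι_apply (R := ℂ) (fun x : Fin N × Bool =>
    MulOpposite.op (letter (x.1, !x.2))) x

/-- The antilinear antimultiplicative involution exchanging `z_i` and `z_i⋆`. -/
instance : StarRing (StarPoly N) where
  star a := (starHom N a).unop
  star_involutive a := by
    induction a using induct with
    | h1 r => simp [starHom_algebraMap]
    | h2 x => simp [starHom_letter]
    | h3 a b ha hb =>
      beta_reduce at ha hb ⊢
      rw [map_mul, MulOpposite.unop_mul, map_mul, MulOpposite.unop_mul, ha, hb]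
    | h4 a b ha hb =>
      beta_reduce at ha hb ⊢
      rw [map_add, MulOpposite.unop_add, map_add, MulOpposite.unop_add, ha, hb]
  star_mul a b := by rw [map_mul, MulOpposite.unop_mul]
  star_add a b := by rw [map_add, MulOpposite.unop_add]

theorem star_letter (x : Fin N × Bool) : star (letter x) = letter (x.1, !x.2) :=
  congrArg MulOpposite.unop (starHom_letter x)

theorem star_algebraMap (c : ℂ) :
    star (algebraMap ℂ (StarPoly N) c) = algebraMap ℂ (StarPoly N) (star c) :=
  congrArg MulOpposite.unop (starHom_algebraMap c)

instance : StarModule ℂ (StarPoly N) where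
  star_smul c a := by
    rw [Algebra.smul_def, star_mul, star_algebraMap, Algebra.smul_def, Algebra.commutes]

variable {B : Type*} [Ring B] [StarRing B] [Algebra ℂ B] [StarModule ℂ B]

/-- Evaluation of a noncommutative polynomial at a tuple of elements of a `⋆`-algebra. -/
def eval (w : Fin N → B) : StarPoly N →⋆ₐ[ℂ] B where
  __ := (FreeAlgebra.lift ℂ fun x : Fin N × Bool => if x.2 then star (w x.1) else w x.1 :
    FreeAlgebra ℂ (Fin N × Bool) →ₐ[ℂ] B)
  map_star' a := by
    let e : StarPoly N →ₐ[ℂ] B := (FreeAlgebra.lift ℂ fun x : Fin N × Bool =>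
      if x.2 then star (w x.1) else w x.1 : FreeAlgebra ℂ (Fin N × Bool) →ₐ[ℂ] B)
    have hl : ∀ x, e (letter x) = if x.2 then star (w x.1) else w x.1 :=
      fun x => FreeAlgebra.lift_ι_apply (R := ℂ) _ x
    change e (star a) = star (e a)
    induction a using induct with
    | h1 r => rw [star_algebraMap, AlgHom.commutes, AlgHom.commutes, algebraMap_star_comm]
    | h2 x =>
      obtain ⟨i, b⟩ := x
      rw [star_letter, hl, hl]
      cases b <;> simp
    | h3 a b ha hb => rw [star_mul, map_mul, map_mul, star_mul, ha, hb]
    | h4 a b ha hb => rw [star_add, map_add, map_add, star_add, ha, hb]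

theorem eval_letter (w : Fin N → B) (x : Fin N × Bool) :
    eval w (letter x) = if x.2 then star (w x.1) else w x.1 :=
  FreeAlgebra.lift_ι_apply (R := ℂ) _ x

end StarPoly

/-- The relations `∑ z_i z_i⋆ = 1 = ∑ z_i⋆ z_i` of the free complex sphere. -/
def SphereRel {N : ℕ} {B : Type*} [Ring B] [StarRing B] (w : Fin N → B) : Prop :=
  ∑ i, w i * star (w i) = 1 ∧ ∑ i, star (w i) * w i = 1

theorem SphereRel.norm_le {N : ℕ} {B : Type*} [CStarAlgebra B] {w : Fin N → B} (hw : SphereRel w)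
    (i : Fin N) : ‖w i‖ ≤ 1 := by
  let _ := CStarAlgebra.spectralOrder B
  have _ := CStarAlgebra.spectralOrderedRing B
  rcases subsingleton_or_nontrivial B with hB | hB
  · rw [Subsingleton.elim (w i) 0, norm_zero]; exact zero_le_one
  have h : star (w i) * w i ≤ 1 := by
    rw [← hw.2]
    exact Finset.single_le_sum (f := fun i => star (w i) * w i)
      (fun j _ => star_mul_self_nonneg (w j)) (Finset.mem_univ i)
  have := CStarAlgebra.norm_le_norm_of_nonneg_of_le (star_mul_self_nonneg (w i)) h
  rw [CStarRing.norm_star_mul_self, norm_one] at this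
  nlinarith [norm_nonneg (w i)]

namespace StarPoly

variable {N : ℕ}

/-- The values at `a` of the norms given by the tuples in C⋆-algebras that satisfy the relations. -/
def repNorms (a : StarPoly N) : Set ℝ :=
  {r | ∃ (B : Type) (_ : CStarAlgebra B) (w : Fin N → B), SphereRel w ∧ r = ‖eval w a‖}

theorem bddAbove_repNorms (a : StarPoly N) : BddAbove (repNorms a) := by
  suffices ∃ C : ℝ, 0 ≤ C ∧ ∀ (B : Type) [CStarAlgebra B] (w : Fin N → B), SphereRel w →
      ‖eval w a‖ ≤ C by
    obtain ⟨C, -, h⟩ := this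
    refine ⟨C, ?_⟩
    rintro r ⟨B, _, w, hw, rfl⟩
    exact h B w hw
  induction a using induct with
  | h1 c =>
    refine ⟨‖c‖ , norm_nonneg c, fun B _ w _ => ?_⟩
    rcases subsingleton_or_nontrivial B with hB | hB
    · rw [Subsingleton.elim (eval w _) 0, norm_zero]; exact norm_nonneg c
    · rw [AlgHomClass.commutes, norm_algebraMap']
  | h2 x =>
    refine ⟨1, zero_le_one, fun B _ w hw => ?_⟩
    rw [eval_letter]
    split_ifs
    · rw [norm_star]; exact hw.norm_le _
    · exact hw.norm_le _
  | h3 a b ha hb =>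
    obtain ⟨C, hC, h⟩ := ha
    obtain ⟨D, hD, k⟩ := hb
    refine ⟨C * D, mul_nonneg hC hD, fun B _ w hw => ?_⟩
    rw [map_mul]
    exact (norm_mul_le _ _).trans (mul_le_mul (h B w hw) (k B w hw) (norm_nonneg _) hC)
  | h4 a b ha hb =>
    obtain ⟨C, hC, h⟩ := ha
    obtain ⟨D, hD, k⟩ := hb
    refine ⟨C + D, add_nonneg hC hD, fun B _ w hw => ?_⟩
    rw [map_add]
    exact (norm_add_le _ _).trans (add_le_add (h B w hw) (k B w hw))

/-- The maximal C⋆-seminorm on noncommutative polynomials modulo the sphere relations. -/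
def maxNorm (a : StarPoly N) : ℝ := sSup (repNorms a)

theorem norm_eval_le_maxNorm {B : Type} [CStarAlgebra B] {w : Fin N → B} (hw : SphereRel w)
    (a : StarPoly N) : ‖eval w a‖ ≤ maxNorm a :=
  le_csSup (bddAbove_repNorms a) ⟨B, _, w, hw, rfl⟩

theorem maxNorm_nonneg (a : StarPoly N) : 0 ≤ maxNorm a := by
  refine Real.sSup_nonneg ?_
  rintro r ⟨B, _, w, hw, rfl⟩
  exact norm_nonneg _

theorem maxNorm_le {a : StarPoly N} {C : ℝ} (hC : 0 ≤ C) (h : ∀ (B : Type) [CStarAlgebra B]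
    (w : Fin N → B), SphereRel w → ‖eval w a‖ ≤ C) : maxNorm a ≤ C := by
  refine Real.sSup_le ?_ hC
  rintro r ⟨B, _, w, hw, rfl⟩
  exact h B w hw

instance : SeminormedRing (StarPoly N) where
  __ := AddGroupSeminorm.toSeminormedAddCommGroup
    { toFun := maxNorm (N := N)
      map_zero' := le_antisymm (maxNorm_le le_rfl fun B _ w _ => by simp) (maxNorm_nonneg _)
      add_le' := fun a b => maxNorm_le (add_nonneg (maxNorm_nonneg a) (maxNorm_nonneg b))
        fun B _ w hw => by
          rw [map_add]
          exact (norm_add_le _ _).trans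
            (add_le_add (norm_eval_le_maxNorm hw a) (norm_eval_le_maxNorm hw b))
      neg' := fun a => by simp only [maxNorm, repNorms, map_neg, norm_neg] }
  __ := (inferInstance : Ring (StarPoly N))
  norm_mul_le a b := maxNorm_le (mul_nonneg (maxNorm_nonneg a) (maxNorm_nonneg b))
    fun B _ w hw => by
      rw [map_mul]
      exact (norm_mul_le _ _).trans (mul_le_mul (norm_eval_le_maxNorm hw a)
        (norm_eval_le_maxNorm hw b) (norm_nonneg _) (maxNorm_nonneg a))

theorem norm_def (a : StarPoly N) : ‖a‖ = maxNorm a := rfl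

instance : NormedAlgebra ℂ (StarPoly N) where
  norm_smul_le c a := maxNorm_le (mul_nonneg (norm_nonneg c) (norm_nonneg a)) fun B _ w hw => by
    rw [map_smul, norm_smul]
    exact mul_le_mul_of_nonneg_left (norm_eval_le_maxNorm hw a) (norm_nonneg c)

instance : NormedStarGroup (StarPoly N) where
  norm_star_le a := maxNorm_le (norm_nonneg a) fun B _ w hw => by
    rw [map_star, norm_star]
    exact norm_eval_le_maxNorm hw a

theorem norm_mul_self_le_star (a : StarPoly N) : ‖a‖ * ‖a‖ ≤ ‖star a * a‖ := by
  have h : ‖a‖ ≤ √‖star a * a‖ := maxNorm_le (Real.sqrt_nonneg _) fun B _ w hw => by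
    refine Real.le_sqrt_of_sq_le ?_
    rw [sq, ← CStarRing.norm_star_mul_self, ← map_star, ← map_mul]
    exact norm_eval_le_maxNorm hw _
  calc _ ≤ √‖star a * a‖ * √‖star a * a‖ := by gcongr
    _ = _ := Real.mul_self_sqrt (norm_nonneg _)

end StarPoly

/-- The C⋆-algebra `C(S^{N-1}_{ℂ,+})` of the free complex sphere: the universal C⋆-algebra generated
by `z₁, …, z_N` with `∑ z_i z_i⋆ = 1 = ∑ z_i⋆ z_i`, i.e. the separated completion of the
noncommutative polynomials for the maximal C⋆-seminorm. -/
def FreeSphere (N : ℕ) : Type := UniformSpace.Completion (StarPoly N)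

namespace FreeSphere

open UniformSpace

variable {N : ℕ}

instance : NormedRing (FreeSphere N) := inferInstanceAs (NormedRing (Completion (StarPoly N)))

instance : CompleteSpace (FreeSphere N) := inferInstanceAs (CompleteSpace (Completion (StarPoly N)))

instance : Algebra ℂ (FreeSphere N) := inferInstanceAs (Algebra ℂ (Completion (StarPoly N)))

instance : NormedAlgebra ℂ (FreeSphere N) where
  norm_smul_le := (inferInstance : NormedSpace ℂ (Completion (StarPoly N))).norm_smul_le

/-- The image of a polynomial. -/
def ofPoly (a : StarPoly N) : FreeSphere N := (a : Completion (StarPoly N))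

theorem norm_ofPoly (a : StarPoly N) : ‖ofPoly a‖ = ‖a‖ := Completion.norm_coe a

theorem continuous_ofPoly : Continuous (ofPoly : StarPoly N → FreeSphere N) :=
  Completion.continuous_coe _

theorem denseRange_ofPoly : DenseRange (ofPoly : StarPoly N → FreeSphere N) :=
  Completion.denseRange_coe

theorem ofPoly_add (a b : StarPoly N) : ofPoly (a + b) = ofPoly a + ofPoly b :=
  Completion.coe_add a b

theorem ofPoly_mul (a b : StarPoly N) : ofPoly (a * b) = ofPoly a * ofPoly b :=
  Completion.coe_mul a b

theorem ofPoly_one : ofPoly (1 : StarPoly N) = 1 := rfl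

theorem ofPoly_smul (c : ℂ) (a : StarPoly N) : ofPoly (c • a) = c • ofPoly a :=
  Completion.coe_smul c a

theorem ofPoly_algebraMap (c : ℂ) :
    ofPoly (algebraMap ℂ (StarPoly N) c) = algebraMap ℂ (FreeSphere N) c := rfl

/-- The extension by continuity of the involution of polynomials. -/
def starFun : FreeSphere N → FreeSphere N := Completion.map (star : StarPoly N → StarPoly N)

theorem uniformContinuous_star' : UniformContinuous (star : StarPoly N → StarPoly N) :=
  (starₗᵢ ℂ : StarPoly N ≃ₗᵢ⋆[ℂ] StarPoly N).isometry.uniformContinuous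

theorem continuous_starFun : Continuous (starFun : FreeSphere N → FreeSphere N) :=
  Completion.continuous_map

theorem starFun_ofPoly (a : StarPoly N) : starFun (ofPoly a) = ofPoly (star a) :=
  Completion.map_coe uniformContinuous_star' a


instance : StarRing (FreeSphere N) where
  star := starFun
  star_involutive := congrFun <| denseRange_ofPoly.equalizer
    (continuous_starFun.comp continuous_starFun) continuous_id <| funext fun a => by
      simp only [Function.comp_apply, starFun_ofPoly, star_star]
  star_add x y := by
    refine isClosed_property2 denseRange_ofPoly
      (p := fun x y => starFun (x + y) = starFun x + starFun y) (isClosed_eq ?_ ?_)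
      (fun a b => ?_) x y
    · exact continuous_starFun.comp (by fun_prop)
    · exact (continuous_starFun.comp continuous_fst).add (continuous_starFun.comp continuous_snd)
    · rw [← ofPoly_add, starFun_ofPoly, starFun_ofPoly, starFun_ofPoly, star_add, ofPoly_add]
  star_mul x y := by
    refine isClosed_property2 denseRange_ofPoly
      (p := fun x y => starFun (x * y) = starFun y * starFun x) (isClosed_eq ?_ ?_)
      (fun a b => ?_) x y
    · exact continuous_starFun.comp (by fun_prop)
    · exact (continuous_starFun.comp continuous_snd).mul (continuous_starFun.comp continuous_fst)
    · rw [← ofPoly_mul, starFun_ofPoly, starFun_ofPoly, starFun_ofPoly, star_mul, ofPoly_mul]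

theorem star_ofPoly (a : StarPoly N) : star (ofPoly a) = ofPoly (star a) := starFun_ofPoly a

theorem continuous_star' : Continuous (star : FreeSphere N → FreeSphere N) := continuous_starFun

instance : CStarAlgebra (FreeSphere N) where
  norm_mul_self_le x := by
    refine isClosed_property denseRange_ofPoly
      (p := fun x : FreeSphere N => ‖x‖ * ‖x‖ ≤ ‖star x * x‖) (isClosed_le (by fun_prop) ?_)
      (fun a => ?_) x
    · exact (continuous_star'.mul continuous_id).norm
    · rw [star_ofPoly, ← ofPoly_mul, norm_ofPoly, norm_ofPoly]
      exact StarPoly.norm_mul_self_le_star a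
  star_smul c x := by
    have h1 : Continuous fun x : FreeSphere N => star (c • x) :=
      continuous_star'.comp (continuous_const_smul c)
    have h2 : Continuous fun x : FreeSphere N => star c • star x :=
      (continuous_const_smul (star c)).comp continuous_star'
    refine congrFun (denseRange_ofPoly.equalizer h1 h2 (funext fun a => ?_)) x
    simp only [Function.comp_apply]
    rw [← ofPoly_smul, star_ofPoly, star_ofPoly, star_smul, ofPoly_smul]

/-- The standard coordinates `z_i ∈ C(S^{N-1}_{ℂ,+})`. -/
def z (i : Fin N) : FreeSphere N := ofPoly (StarPoly.letter (i, false))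

theorem star_z (i : Fin N) : star (z i) = ofPoly (StarPoly.letter (i, true)) := by
  rw [z, star_ofPoly, StarPoly.star_letter]; rfl

theorem ofPoly_eq_of_eval {a b : StarPoly N} (h : ∀ (B : Type) [CStarAlgebra B]
    (w : Fin N → B), SphereRel w → StarPoly.eval w a = StarPoly.eval w b) :
    ofPoly a = ofPoly b := by
  have h0 : ‖a - b‖ ≤ 0 := StarPoly.maxNorm_le le_rfl fun B _ w hw => by
    rw [map_sub, h B w hw, sub_self, norm_zero]
  have h1 : ofPoly (a - b) + ofPoly b = ofPoly a := by rw [← ofPoly_add, sub_add_cancel]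
  have h2 : ofPoly (a - b) = 0 := by
    rw [← norm_le_zero_iff, norm_ofPoly]; exact h0
  rw [← h1, h2, zero_add]

/-- The polynomials inside `C(S^{N-1}_{ℂ,+})`, as a morphism of `⋆`-algebras. -/
def polyHom (N : ℕ) : StarPoly N →⋆ₐ[ℂ] FreeSphere N where
  toFun := ofPoly
  map_one' := ofPoly_one
  map_mul' := ofPoly_mul
  map_zero' := rfl
  map_add' := ofPoly_add
  commutes' := ofPoly_algebraMap
  map_star' a := (star_ofPoly a).symm

theorem sphereRel_z (N : ℕ) : SphereRel (z : Fin N → FreeSphere N) := by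
  constructor
  · have h := ofPoly_eq_of_eval (N := N)
      (a := ∑ i, StarPoly.letter (i, false) * StarPoly.letter (i, true)) (b := 1)
      fun B _ w hw => by simpa [map_sum, StarPoly.eval_letter] using hw.1
    change polyHom N _ = polyHom N 1 at h
    rw [map_sum, map_one] at h
    simp only [map_mul] at h
    simp only [star_z]
    exact h
  · have h := ofPoly_eq_of_eval (N := N)
      (a := ∑ i, StarPoly.letter (i, true) * StarPoly.letter (i, false)) (b := 1)
      fun B _ w hw => by simpa [map_sum, StarPoly.eval_letter] using hw.2
    change polyHom N _ = polyHom N 1 at h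
    rw [map_sum, map_one] at h
    simp only [map_mul] at h
    simp only [star_z]
    exact h

section lift

variable {B : Type} [CStarAlgebra B] {w : Fin N → B}

theorem continuous_eval (hw : SphereRel w) : Continuous (StarPoly.eval w) :=
  AddMonoidHomClass.continuous_of_bound (StarPoly.eval w) 1 fun a => by
    rw [one_mul]; exact StarPoly.norm_eval_le_maxNorm hw a

/-- The ring morphism underlying `lift`. -/
def liftRing (hw : SphereRel w) : FreeSphere N →+* B :=
  Completion.extensionHom (StarPoly.eval w : StarPoly N →+* B) (continuous_eval hw)

theorem liftRing_ofPoly (hw : SphereRel w) (a : StarPoly N) :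
    liftRing hw (ofPoly a) = StarPoly.eval w a :=
  Completion.extensionHom_coe (StarPoly.eval w : StarPoly N →+* B) (continuous_eval hw) a

theorem continuous_liftRing (hw : SphereRel w) : Continuous (liftRing hw) :=
  Completion.continuous_extension

/-- The universal property of `C(S^{N-1}_{ℂ,+})`: a tuple in a C⋆-algebra that satisfies the
relations defines a morphism of C⋆-algebras. -/
def lift (hw : SphereRel w) : FreeSphere N →⋆ₐ[ℂ] B where
  __ := liftRing hw
  commutes' c := by
    change liftRing hw (algebraMap ℂ (FreeSphere N) c) = _
    rw [← ofPoly_algebraMap, liftRing_ofPoly, AlgHomClass.commutes]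
  map_star' x := by
    refine isClosed_property denseRange_ofPoly
      (p := fun x : FreeSphere N => liftRing hw (star x) = star (liftRing hw x))
      (isClosed_eq ?_ ?_) (fun a => ?_) x
    · exact (continuous_liftRing hw).comp continuous_star'
    · exact (continuous_liftRing hw).star
    · rw [star_ofPoly, liftRing_ofPoly, liftRing_ofPoly, map_star]

theorem lift_z (hw : SphereRel w) (i : Fin N) : lift hw (z i) = w i := by
  change liftRing hw (ofPoly _) = _
  rw [liftRing_ofPoly, StarPoly.eval_letter]
  simp

end lift

/-- Morphisms out of `C(S^{N-1}_{ℂ,+})` are determined by the images of the coordinates. -/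
theorem hom_ext {B : Type*} [CStarAlgebra B] {f g : FreeSphere N →⋆ₐ[ℂ] B}
    (h : ∀ i, f (z i) = g (z i)) : f = g := by
  have hp : ∀ a : StarPoly N, f (ofPoly a) = g (ofPoly a) := by
    intro a
    induction a using StarPoly.induct with
    | h1 r => rw [ofPoly_algebraMap, AlgHomClass.commutes, AlgHomClass.commutes]
    | h2 x =>
      obtain ⟨i, b⟩ := x
      cases b
      · exact h i
      · rw [← star_z, map_star, map_star, h]
    | h3 a b ha hb => rw [ofPoly_mul, map_mul, map_mul, ha, hb]
    | h4 a b ha hb => rw [ofPoly_add, map_add, map_add, ha, hb]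
  have hc : ∀ k : FreeSphere N →⋆ₐ[ℂ] B, Continuous k := fun k =>
    AddMonoidHomClass.continuous_of_bound k 1 fun a => by
      rw [one_mul]; exact NonUnitalStarAlgHom.norm_apply_le k a
  exact DFunLike.coe_injective (denseRange_ofPoly.equalizer (hc f) (hc g) (funext hp))

theorem sphereRel_rotate (ω : Circle) :
    SphereRel fun i : Fin N => (ω : ℂ) • (z i : FreeSphere N) := by
  have h1 : (ω : ℂ) * star (ω : ℂ) = 1 := by
    rw [Complex.star_def, Complex.mul_conj, Circle.normSq_coe, Complex.ofReal_one]
  have h2 : star (ω : ℂ) * (ω : ℂ) = 1 := by rw [mul_comm, h1]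
  constructor
  · simpa only [star_smul, smul_mul_smul_comm, h1, one_smul] using (sphereRel_z N).1
  · simpa only [star_smul, smul_mul_smul_comm, h2, one_smul] using (sphereRel_z N).2

/-- The rotation `z_i ↦ ω z_i` of the free complex sphere, for `ω` on the unit circle. -/
def rotate (ω : Circle) : FreeSphere N →⋆ₐ[ℂ] FreeSphere N := lift (sphereRel_rotate ω)

theorem rotate_z (ω : Circle) (i : Fin N) : rotate ω (z i) = (ω : ℂ) • (z i : FreeSphere N) :=
  lift_z _ i

end FreeSphere

section CompactSpaces

variable {A : Type*} [CStarAlgebra A]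

/-- The ordered monomial `x_{i_1} ⋯ x_{i_K}`. -/
def orderedProd {N K : ℕ} (x : Fin N → A) (i : Fin K → Fin N) : A :=
  (List.ofFn fun c => x (i c)).prod

/-- The commutators `[z_{i_1} ⋯ z_{i_K}, z_{j_1} ⋯ z_{j_K}]` and
`[z_{i_1} ⋯ z_{i_K}, z_{j_1}⋆ ⋯ z_{j_K}⋆]`. -/
def kCommutators {N : ℕ} (K : ℕ) (x : Fin N → A) : Set A :=
  {a | ∃ i j : Fin K → Fin N,
    a = orderedProd x i * orderedProd x j - orderedProd x j * orderedProd x i ∨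
    a = orderedProd x i * orderedProd (fun l => star (x l)) j
        - orderedProd (fun l => star (x l)) j * orderedProd x i}

/-- For a closed subspace `X` of the free complex sphere, given by the (surjective) restriction map
`q : C(S^{N-1}_{ℂ,+}) → C(X)`: the action of the `K`-th roots of unity by `z_i ↦ ω z_i` on
`C(S^{N-1}_{ℂ,+})` induces an action on `C(X)`. -/
def IsKSymmetric {N : ℕ} (K : ℕ) (q : FreeSphere N →⋆ₐ[ℂ] A) : Prop :=
  ∃ ρ : rootsOfUnity K Circle →* (A ≃⋆ₐ[ℂ] A), ∀ (ω : rootsOfUnity K Circle) (a : FreeSphere N),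
    ρ ω (q a) = q (FreeSphere.rotate ((ω : Circleˣ) : Circle) a)

/-- The closed ideal of `C(X)` defining the closed subspace `X_{1/K-class} ⊂ X`. -/
def kClassIdeal {N : ℕ} (K : ℕ) (q : FreeSphere N →⋆ₐ[ℂ] A) : ClosedIdeal A :=
  ClosedIdeal.span (kCommutators K fun i => q (FreeSphere.z i))

theorem isClosed_ker_matrix {L : ℕ} (φ : A →⋆ₐ[ℂ] Matrix (Fin L) (Fin L) ℂ) :
    IsClosed {a : A | φ a = 0} := by
  open scoped Matrix.Norms.L2Operator in
  let _ : CStarAlgebra (Matrix (Fin L) (Fin L) ℂ) := { }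
  have h : Continuous φ := AddMonoidHomClass.continuous_of_bound φ 1 fun a => by
    rw [one_mul]; exact NonUnitalStarAlgHom.norm_apply_le φ a
  exact isClosed_eq h continuous_const

/-- The closed ideal `J_K`, the intersection of the kernels of all the representations
`A → M_L(ℂ)` with `L ≤ K`. For `A = C(X)` it defines the closed subspace `X^{(K)} ⊂ X`. -/
def repIdeal (A : Type*) [CStarAlgebra A] (K : ℕ) : ClosedIdeal A where
  toIdeal := ⨅ (L : ℕ) (_ : L ≤ K) (φ : A →⋆ₐ[ℂ] Matrix (Fin L) (Fin L) ℂ), RingHom.ker φ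
  mul_mem_right := by
    intro x y hx
    simp only [Submodule.mem_iInf, RingHom.mem_ker] at hx ⊢
    intro L hL φ
    rw [map_mul, hx L hL φ, zero_mul]
  isClosed := by
    simp only [Submodule.coe_iInf]
    exact isClosed_iInter fun L => isClosed_iInter fun _ => isClosed_iInter isClosed_ker_matrix

/-- Inclusion `Y ⊂ Z` of the closed subspaces of `X` (where `A = C(X)`) defined by two closed
ideals: the restriction map `C(X) → C(Y)` factorizes through a morphism `C(Z) → C(Y)`, which is
then surjective. -/
def SubspaceIncl (Y Z : ClosedIdeal A) : Prop :=
  ∃ f : Z.Quot →⋆ₐ[ℂ] Y.Quot, Function.Surjective f ∧ ∀ a : A, f (Z.quotMap a) = Y.quotMap a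

end CompactSpaces

/-- The product `(S^{N-1}_ℂ)^K` of usual complex spheres. -/
abbrev SpherePow (N K : ℕ) : Type :=
  Fin K → Metric.sphere (0 : EuclideanSpace ℂ (Fin N)) 1

/-- Stability under the cyclic action of `ℤ_K` on `(S^{N-1}_ℂ)^K` (stated for a generator). -/
def IsCyclicSymmetric {N K : ℕ} (T : Set (SpherePow N K)) : Prop :=
  ∀ x ∈ T, x ∘ finRotate K ∈ T

end

/-! Write `B` for the quotient algebra and `σ` for its automorphism rotating all coordinates by a
primitive `K`-th root of unity `ζ`. The eigenspaces of `σ` grade `B` by `ℤ/K`, and the averaging map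
`eigenProj σ K 1` is a faithful projection onto the degree zero part.

The degree zero part is commutative (`FreeSphere.commute_of_fixed`). The sphere relations allow `1`
to be inserted as a combination of products of a word by an adjoint word. This rewrites every
polynomial as a sum of terms `V ^ s * D` with `s < K`, where `V` is the span of the coordinates and
`D` is generated by the words of length `K` and their adjoint analogues. Averaging leaves only `s =
0`, and the half-liberation relations make `D` commutative.

A character of the degree zero part, composed with the average, is a state `χ` on `B`. Both `x⋆y`
and `xy⋆` have degree zero when `x`, `y` have the same degree, and their commutation forces the rank
one identity `star_mul_mul_star_mul`. Hence each graded piece is a line in the GNS space of `χ`; it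
is nonzero by the sphere relations. The GNS space has dimension `K`, and in a homogeneous
orthonormal basis (`IsFixedCharacter.exists_matrix_rep`) each coordinate raises the degree by one,
so it acts as a weighted cyclic shift. The weights form a point of `(S^{N-1}_ℂ)^K`.

The set `T` consists of all points whose shift representation factorizes through `B`. Characters
separate the degree zero part and averaging is faithful, so these representations separate `B`
(`eq_zero_of_shiftModel`). They are `K`-dimensional, which also gives the inclusion in `X^{(K)}`. -/

noncomputable section

open StarAlgHom

/-! ### Spectral decomposition for a finite cyclic action -/

namespace StarAlgHom

variable {B : Type*} [CStarAlgebra B]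

/-- The eigenspace of a star endomorphism for the eigenvalue `c`. -/
def eigen (σ : B →⋆ₐ[ℂ] B) (c : ℂ) : Submodule ℂ B where
  carrier := {x | σ x = c • x}
  add_mem' {x y} (hx : σ x = _) (hy : σ y = _) := by
    change σ (x + y) = c • (x + y)
    rw [map_add, hx, hy, smul_add]
  zero_mem' := by change σ 0 = c • 0; rw [map_zero, smul_zero]
  smul_mem' d x (hx : σ x = _) := by
    change σ (d • x) = c • d • x
    rw [map_smul, hx, smul_comm]

variable {σ : B →⋆ₐ[ℂ] B} {c d : ℂ} {x y : B}

theorem mem_eigen : x ∈ eigen σ c ↔ σ x = c • x := Iff.rfl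

theorem mem_eigen_one : x ∈ eigen σ 1 ↔ σ x = x := by rw [mem_eigen, one_smul]

theorem mul_mem_eigen (hx : x ∈ eigen σ c) (hy : y ∈ eigen σ d) : x * y ∈ eigen σ (c * d) := by
  rw [mem_eigen] at *
  rw [map_mul, hx, hy, smul_mul_smul_comm]

theorem eigen_mul_le : eigen σ c * eigen σ d ≤ eigen σ (c * d) :=
  Submodule.mul_le.2 fun _ hx _ hy => mul_mem_eigen hx hy

theorem one_le_eigen_one : 1 ≤ eigen σ 1 :=
  Submodule.one_le.2 <| by rw [mem_eigen_one, map_one]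

theorem pow_le_eigen {V : Submodule ℂ B} (hV : V ≤ eigen σ c) (n : ℕ) : V ^ n ≤ eigen σ (c ^ n) := by
  induction n with
  | zero => rw [pow_zero, pow_zero]; exact one_le_eigen_one
  | succ n ih => rw [pow_succ, pow_succ]; exact (mul_le_mul' ih hV).trans eigen_mul_le

theorem star_mem_eigen (hx : x ∈ eigen σ c) : star x ∈ eigen σ (star c) := by
  rw [mem_eigen] at *
  rw [map_star, hx, star_smul]

variable (σ) in
/-- The projection onto the eigenspace for `c`, for a star endomorphism with `σ ^ K = 1` and
a `K`-th root of unity `c`. -/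
def eigenProj (K : ℕ) (c : ℂ) : B →ₗ[ℂ] B :=
  (K : ℂ)⁻¹ • ∑ k ∈ Finset.range K, (c⁻¹) ^ k • (σ : B →ₐ[ℂ] B).toLinearMap ^ k

theorem eigenProj_apply (K : ℕ) (c : ℂ) (x : B) : eigenProj σ K c x =
    (K : ℂ)⁻¹ • ∑ k ∈ Finset.range K, (c⁻¹) ^ k • σ^[k] x := by
  simp only [eigenProj, LinearMap.smul_apply, LinearMap.sum_apply, Module.End.pow_apply]
  rfl

theorem continuous_eigenProj (K : ℕ) (c : ℂ) : Continuous (eigenProj σ K c) := by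
  have hσ : Continuous σ := AddMonoidHomClass.continuous_of_bound σ 1 fun a => by
    rw [one_mul]; exact NonUnitalStarAlgHom.norm_apply_le σ a
  rw [funext (eigenProj_apply (σ := σ) K c)]
  exact (continuous_finsetSum _ fun k _ => (hσ.iterate k).const_smul _).const_smul _

section Periodic

variable {K : ℕ} (hσ : ∀ x, σ^[K] x = x)
include hσ

theorem eigenProj_mem (hc : c ^ K = 1) (hK : K ≠ 0) : eigenProj σ K c x ∈ eigen σ c := by
  have hc0 : c ≠ 0 := by rintro rfl; rw [zero_pow hK] at hc; exact zero_ne_one hc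
  rw [mem_eigen, eigenProj_apply, map_smul, map_sum, smul_comm c]
  congr 1
  -- The terms `k = 0` and `k = K` coincide, so the sum over a period is unchanged when `k` is
  -- shifted by one.
  have h := Finset.sum_range_succ' (fun k => (c⁻¹) ^ k • σ^[k] x) K
  rw [Finset.sum_range_succ, hσ, inv_pow, hc, inv_one] at h
  simp only [pow_zero, Function.iterate_zero, id] at h
  rw [add_right_cancel h, Finset.smul_sum]
  refine Finset.sum_congr rfl fun k _ => ?_
  rw [map_smul, ← Function.iterate_succ_apply' σ, smul_smul, pow_succ', mul_inv_cancel_left₀ hc0]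

end Periodic

theorem iterate_of_mem_eigen (hx : x ∈ eigen σ c) (k : ℕ) : σ^[k] x = c ^ k • x := by
  induction k with
  | zero => simp
  | succ k ih => rw [Function.iterate_succ_apply', ih, map_smul, hx, smul_smul, pow_succ]

theorem eigenProj_one_of_mem {K : ℕ} (hK : K ≠ 0) (hx : x ∈ eigen σ 1) :
    eigenProj σ K 1 x = x := by
  have hK' : (K : ℂ) ≠ 0 := Nat.cast_ne_zero.2 hK
  simp [eigenProj_apply, iterate_of_mem_eigen hx, ← Nat.cast_smul_eq_nsmul ℂ, smul_smul, hK']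

theorem eigenProj_one_eq_zero {K : ℕ} (hc : c ^ K = 1) (hc1 : c ≠ 1) (hx : x ∈ eigen σ c) :
    eigenProj σ K 1 x = 0 := by
  simp only [eigenProj_apply, iterate_of_mem_eigen hx, inv_one, one_pow, one_smul]
  rw [← Finset.sum_smul]
  have : ∑ k ∈ Finset.range K, c ^ k = 0 := by
    rw [geom_sum_eq hc1, hc, sub_self, zero_div]
  rw [this, zero_smul, smul_zero]

theorem star_eigenProj_one (K : ℕ) (x : B) :
    eigenProj σ K 1 (star x) = star (eigenProj σ K 1 x) := by
  have h : ∀ k, σ^[k] (star x) = star (σ^[k] x) := fun k => by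
    induction k with
    | zero => rfl
    | succ k ih => rw [Function.iterate_succ_apply', ih, Function.iterate_succ_apply', map_star]
  simp [eigenProj_apply, star_smul, star_sum, h]

theorem eigenProj_one_map {K : ℕ} (hσ : ∀ x, σ^[K] x = x) (x : B) :
    eigenProj σ K 1 (σ x) = eigenProj σ K 1 x := by
  simp only [eigenProj_apply, inv_one, one_pow, one_smul]
  have h := Finset.sum_range_succ' (fun k => σ^[k] x) K
  rw [Finset.sum_range_succ, hσ] at h
  simp only [Function.iterate_zero, id] at h
  rw [add_right_cancel h]
  rfl

/-- The average of `x⋆x` is a multiple of a sum of the positive elements `σ^k(x)⋆σ^k(x)`. If it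
vanishes so does each term, in particular `k = 0`: the conditional expectation is faithful. -/
theorem eq_zero_of_eigenProj_one {K : ℕ} (hK : K ≠ 0) (h : eigenProj σ K 1 (star x * x) = 0) :
    x = 0 := by
  let _ := CStarAlgebra.spectralOrder B
  have _ := CStarAlgebra.spectralOrderedRing B
  have hK' : (K : ℂ)⁻¹ ≠ 0 := inv_ne_zero (Nat.cast_ne_zero.2 hK)
  have hit : ∀ k, σ^[k] (star x * x) = star (σ^[k] x) * σ^[k] x := fun k => by
    induction k with
    | zero => rfl
    | succ k ih => simp only [Function.iterate_succ_apply', ih, map_star, map_mul]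
  simp only [eigenProj_apply, inv_one, one_pow, one_smul, smul_eq_zero_iff_right hK', hit] at h
  have := (Finset.sum_eq_zero_iff_of_nonneg fun k _ => star_mul_self_nonneg (σ^[k] x)).1 h 0
    (Finset.mem_range.2 (Nat.pos_of_ne_zero hK))
  exact CStarRing.star_mul_self_eq_zero_iff _ |>.1 this

/-- Fourier inversion on `ℤ/K`: in the sum of all the spectral projections of `x`, the coefficient
of `σ^k x` is a geometric sum that vanishes unless `k = 0`. -/
theorem iSup_eigen_eq_top {K : ℕ} {ζ : ℂ} (hK : K ≠ 0) (hζ : IsPrimitiveRoot ζ K)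
    (hσ : ∀ x, σ^[K] x = x) : ⨆ e : Fin K, eigen σ (ζ ^ (e : ℕ)) = ⊤ := by
  have hK' : (K : ℂ) ≠ 0 := Nat.cast_ne_zero.2 hK
  refine eq_top_iff.2 fun x _ => ?_
  have hx : x = ∑ e : Fin K, eigenProj σ K (ζ ^ (e : ℕ)) x := by
    rw [Fin.sum_univ_eq_sum_range (fun e => eigenProj σ K (ζ ^ e) x)]
    simp only [eigenProj_apply]
    rw [← Finset.smul_sum, Finset.sum_comm]
    have : ∀ k ∈ Finset.range K, ∑ e ∈ Finset.range K, ((ζ ^ e)⁻¹) ^ k • σ^[k] x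
        = if k = 0 then (K : ℂ) • x else 0 := by
      intro k hk
      rw [← Finset.sum_smul]
      split_ifs with h0
      · subst h0; simp
      · have h1 : ∀ e, ((ζ ^ e)⁻¹) ^ k = ((ζ⁻¹) ^ k) ^ e := fun e => by
          rw [← inv_pow, ← pow_mul, ← pow_mul, mul_comm]
        simp only [h1]
        have h2 : (ζ⁻¹) ^ k ≠ 1 := hζ.inv.pow_ne_one_of_pos_of_lt h0 (Finset.mem_range.1 hk)
        rw [geom_sum_eq h2, ← pow_mul, mul_comm k, pow_mul, inv_pow, hζ.pow_eq_one]
        simp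
    rw [Finset.sum_congr rfl this, Finset.sum_ite_eq' , if_pos (by simpa using Nat.pos_of_ne_zero hK),
      smul_smul, inv_mul_cancel₀ hK', one_smul]
  rw [hx]
  refine Submodule.sum_mem _ fun e _ => Submodule.mem_iSup_of_mem e (eigenProj_mem hσ ?_ hK)
  rw [← pow_mul, mul_comm, pow_mul, hζ.pow_eq_one, one_pow]

end StarAlgHom

/-! ### The rank one identity -/

section RankOne

variable {B : Type*} [CStarAlgebra B]

/-- With `u = a⋆a b⋆b` and `v = a⋆b b⋆a`, both selfadjoint, the commutations give `uv = v²` and `u²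
= vu`. Hence `(u - v)² = 0`, and the C⋆-identity gives `u = v`. -/
theorem star_mul_mul_star_mul_self {a b : B}
    (h : ∀ x ∈ ({a, b} : Set B), ∀ y ∈ ({a, b} : Set B), ∀ z ∈ ({a, b} : Set B),
      ∀ w ∈ ({a, b} : Set B), Commute (star x * y) (star z * w) ∧ Commute (x * star y) (z * star w)) :
    star a * b * (star b * a) = star a * a * (star b * b) := by
  have ha : a ∈ ({a, b} : Set B) := by simp
  have hb : b ∈ ({a, b} : Set B) := by simp
  set u := star a * a * (star b * b) with hu
  set v := star a * b * (star b * a) with hv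
  have e1 : u * v = v * v := by
    calc u * v = (star a * a) * ((star b * b) * (star a * b)) * (star b * a) := by
          rw [hu, hv]; noncomm_ring
      _ = (star a * a) * ((star a * b) * (star b * b)) * (star b * a) := by
          rw [(h b hb b hb a ha b hb).1.eq]
      _ = star a * ((a * star a) * (b * star b)) * (b * star b) * a := by noncomm_ring
      _ = star a * ((b * star b) * (a * star a)) * (b * star b) * a := by
          rw [(h a ha a ha b hb b hb).2.eq]
      _ = v * v := by rw [hv]; noncomm_ring
  have e2 : u * u = v * u := by
    calc u * u = star a * a * ((star b * b) * (star a * a)) * (star b * b) := by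
          rw [hu]; noncomm_ring
      _ = star a * a * ((star a * a) * (star b * b)) * (star b * b) := by
          rw [(h b hb b hb a ha a ha).1.eq]
      _ = star a * (a * star a) * (a * star b) * (b * star b) * b := by noncomm_ring
      _ = star a * ((a * star a) * ((a * star b) * (b * star b))) * b := by noncomm_ring
      _ = star a * (((a * star a) * (b * star b)) * (a * star b)) * b := by
          rw [(h a ha b hb b hb b hb).2.eq]; noncomm_ring
      _ = star a * ((b * star b) * (a * star a) * (a * star b)) * b := by
          rw [(h a ha a ha b hb b hb).2.eq]
      _ = v * u := by rw [hu, hv]; noncomm_ring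
  have hsu : star u = u := by
    rw [hu]; simp only [star_mul, star_star]; exact (h b hb b hb a ha a ha).1.eq
  have hsv : star v = v := by
    rw [hv]; simp only [star_mul, star_star]
  have : star (u - v) * (u - v) = 0 := by
    rw [star_sub, hsu, hsv]
    have : (u - v) * (u - v) = (u * u - v * u) - (u * v - v * v) := by noncomm_ring
    rw [this, e1, e2, sub_self, sub_self, sub_self]
  exact (sub_eq_zero.1 (CStarRing.star_mul_self_eq_zero_iff _ |>.1 this)).symm

/-- Polarization of the case `a = c`: the sesquilinear form `S` vanishes on the diagonal of `H`, and
testing it on `a + c` and `a + ic` kills `S a c`. -/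
theorem star_mul_mul_star_mul {H : Submodule ℂ B}
    (h : ∀ x ∈ H, ∀ y ∈ H, ∀ z ∈ H, ∀ w ∈ H,
      Commute (star x * y) (star z * w) ∧ Commute (x * star y) (z * star w))
    {a b c : B} (ha : a ∈ H) (hb : b ∈ H) (hc : c ∈ H) :
    star a * b * (star b * c) = star a * c * (star b * b) := by
  have hd : ∀ x ∈ H, star x * b * (star b * x) = star x * x * (star b * b) := fun x hx => by
    have hs : ({x, b} : Set B) ⊆ H := by
      rintro y (rfl | rfl)
      exacts [hx, hb]
    exact star_mul_mul_star_mul_self fun y hy z hz w hw t ht =>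
      h y (hs hy) z (hs hz) w (hs hw) t (hs ht)
  let S : B → B → B := fun x y => star x * b * (star b * y) - star x * y * (star b * b)
  have hS : ∀ x ∈ H, S x x = 0 := fun x hx => sub_eq_zero.2 (hd x hx)
  have h1 := hS (a + c) (H.add_mem ha hc)
  have h2 := hS (a + Complex.I • c) (H.add_mem ha (H.smul_mem _ hc))
  have e1 : S (a + c) (a + c) = S a a + S c c + (S a c + S c a) := by
    simp only [S, star_add]; noncomm_ring
  have e2 : S (a + Complex.I • c) (a + Complex.I • c)
      = S a a + S c c + Complex.I • (S a c - S c a) := by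
    simp only [S, star_add, star_smul, add_mul, mul_add, smul_mul_assoc, mul_smul_comm, smul_add,
      smul_sub, smul_smul, Complex.star_def, Complex.conj_I, neg_smul, smul_neg, neg_mul,
      Complex.I_mul_I, one_smul, neg_neg]
    abel
  rw [e1, hS a ha, hS c hc, zero_add, zero_add] at h1
  rw [e2, hS a ha, hS c hc, zero_add, zero_add, smul_eq_zero_iff_right Complex.I_ne_zero] at h2
  have h3 : (2 : ℂ) • S a c = 0 := by
    have : (2 : ℂ) • S a c = (S a c + S c a) + (S a c - S c a) := by rw [two_smul]; abel
    rw [this, h1, h2, add_zero]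
  exact sub_eq_zero.1 ((smul_eq_zero_iff_right two_ne_zero).1 h3)

end RankOne

/-! ### Words in the coordinates and the block algebra -/

section Words

variable {B : Type*} [CStarAlgebra B] {N : ℕ} (w : Fin N → B)

/-- The linear span of the coordinates. -/
def coordSpan : Submodule ℂ B := Submodule.span ℂ (Set.range w)

variable (K : ℕ)

theorem mem_coordSpan (i : Fin N) : w i ∈ coordSpan w := Submodule.subset_span ⟨i, rfl⟩

theorem coordSpan_pow : coordSpan w ^ K = Submodule.span ℂ (Set.range (orderedProd (K := K) w)) := by
  rw [coordSpan, Submodule.span_pow]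
  congr 1
  ext x
  rw [Set.mem_pow]
  constructor
  · rintro ⟨f, rfl⟩
    choose i hi using fun c => (f c).2
    exact ⟨i, by simp only [orderedProd, hi]⟩
  · rintro ⟨i, rfl⟩
    exact ⟨fun c => ⟨w (i c), i c, rfl⟩, rfl⟩

/-- The algebra generated by the words of length `K` in the coordinates, and in their adjoints. -/
def blockAlgebra : Subalgebra ℂ B :=
  Algebra.adjoin ℂ (Set.range (orderedProd (K := K) w) ∪
    Set.range (orderedProd (K := K) fun l => star (w l)))

variable {w K}

theorem star_orderedProd (i : Fin K → Fin N) :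
    star (orderedProd w i) = orderedProd (fun l => star (w l)) (i ∘ Fin.rev) := by
  have h : ∀ l : List B, star l.prod = (l.map star).reverse.prod := fun l => by
    induction l with
    | nil => simp
    | cons a l ih => simp [ih]
  rw [orderedProd, h, orderedProd, List.map_ofFn]
  congr 1
  refine List.ext_getElem (by simp) fun n h1 h2 => ?_
  simp only [List.length_reverse, List.length_ofFn] at h1
  simp only [List.getElem_reverse, List.getElem_ofFn, Function.comp_apply, List.length_ofFn]
  congr 3
  exact Fin.ext (by simp only [Fin.val_rev]; omega)

/-- Commutation need only be checked on generators. The relations omit pairs of adjoint words; these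
follow by taking adjoints, at the price of reversing the words. -/
theorem commute_of_mem_blockAlgebra (h : ∀ a ∈ kCommutators K w, a = 0) {x y : B}
    (hx : x ∈ blockAlgebra w K) (hy : y ∈ blockAlgebra w K) : Commute x y := by
  have h1 : ∀ i j : Fin K → Fin N, Commute (orderedProd w i) (orderedProd w j) := fun i j =>
    sub_eq_zero.1 (h _ ⟨i, j, Or.inl rfl⟩)
  have h2 : ∀ i j : Fin K → Fin N,
      Commute (orderedProd w i) (orderedProd (fun l => star (w l)) j) := fun i j =>
    sub_eq_zero.1 (h _ ⟨i, j, Or.inr rfl⟩)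
  have h3 : ∀ i j : Fin K → Fin N, Commute (orderedProd (fun l => star (w l)) i)
      (orderedProd (fun l => star (w l)) j) := fun i j => by
    have hs := (h1 (i ∘ Fin.rev) (j ∘ Fin.rev)).star_star
    rw [star_orderedProd, star_orderedProd] at hs
    simpa [Function.comp_assoc, Fin.rev_involutive.comp_self] using hs
  refine Algebra.commute_of_mem_adjoin_of_forall_mem_commute hy fun b hb => ?_
  refine (Algebra.commute_of_mem_adjoin_of_forall_mem_commute hx fun a ha => ?_).symm
  rcases ha with ⟨i, rfl⟩ | ⟨i, rfl⟩ <;> rcases hb with ⟨j, rfl⟩ | ⟨j, rfl⟩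
  · exact h1 j i
  · exact (h2 i j).symm
  · exact h2 j i
  · exact h3 j i

theorem coordSpan_pow_le : coordSpan w ^ K ≤ Subalgebra.toSubmodule (blockAlgebra w K) := by
  rw [coordSpan_pow]
  exact Submodule.span_le.2 fun x hx => Algebra.subset_adjoin (Or.inl hx)

theorem coordSpan_star_pow_le :
    coordSpan (fun l => star (w l)) ^ K ≤ Subalgebra.toSubmodule (blockAlgebra w K) := by
  rw [coordSpan_pow]
  exact Submodule.span_le.2 fun x hx => Algebra.subset_adjoin (Or.inr hx)

theorem SphereRel.star (hw : SphereRel w) : SphereRel fun l => star (w l) := by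
  simpa only [SphereRel, star_star] using And.symm hw

/-- Nesting `1 = ∑ z_i z_i⋆` inside itself `n` times. This is what permits words to be completed to
length `K`. -/
theorem SphereRel.one_le (hw : SphereRel w) (n : ℕ) :
    1 ≤ coordSpan w ^ n * coordSpan (fun l => Star.star (w l)) ^ n := by
  induction n with
  | zero => simp
  | succ n ih =>
    have h1 : 1 ≤ coordSpan w * coordSpan fun l => Star.star (w l) := by
      rw [Submodule.one_le, ← hw.1]
      exact Submodule.sum_mem _ fun i _ =>
        Submodule.mul_mem_mul (mem_coordSpan w i) (mem_coordSpan _ i)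
    calc 1 ≤ coordSpan w ^ n * 1 * coordSpan (fun l => Star.star (w l)) ^ n := by
          rwa [mul_one]
      _ ≤ coordSpan w ^ n * (coordSpan w * coordSpan fun l => Star.star (w l)) *
          coordSpan (fun l => Star.star (w l)) ^ n := by gcongr
      _ = _ := by rw [pow_succ, pow_succ']; simp only [mul_assoc]

theorem SphereRel.one_le_star (hw : SphereRel w) (n : ℕ) :
    1 ≤ coordSpan (fun l => Star.star (w l)) ^ n * coordSpan w ^ n := by
  simpa only [star_star] using hw.star.one_le n

/-- The sum of the `coordSpan w ^ s * blockAlgebra w K`, for `s < K`. -/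
def blockSum (w : Fin N → B) (K : ℕ) : Submodule ℂ B :=
  ⨆ s : Fin K, coordSpan w ^ (s : ℕ) * Subalgebra.toSubmodule (blockAlgebra w K)

theorem pow_mul_le_blockSum {s : ℕ} (hs : s < K) :
    coordSpan w ^ s * Subalgebra.toSubmodule (blockAlgebra w K) ≤ blockSum w K :=
  le_iSup (fun s : Fin K => coordSpan w ^ (s : ℕ) * Subalgebra.toSubmodule (blockAlgebra w K))
    ⟨s, hs⟩

theorem toSubmodule_le_blockSum (hK : 0 < K) :
    Subalgebra.toSubmodule (blockAlgebra w K) ≤ blockSum w K := by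
  simpa using pow_mul_le_blockSum (w := w) hK

/-- Left multiplication raises the exponent by one; when it reaches `K`, the word of length `K` is
absorbed by the block algebra. -/
theorem coordSpan_mul_blockSum (hK : 0 < K) : coordSpan w * blockSum w K ≤ blockSum w K := by
  rw [blockSum, Submodule.mul_iSup, iSup_le_iff]
  intro s
  rw [← mul_assoc, ← pow_succ']
  rcases Nat.lt_or_eq_of_le (Nat.succ_le_of_lt s.2) with h | h
  · exact pow_mul_le_blockSum h
  · rw [← Nat.succ_eq_add_one, h]
    exact ((mul_le_mul' coordSpan_pow_le le_rfl).trans_eq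
      ((Subalgebra.isIdempotentElem_toSubmodule _).eq)).trans (toSubmodule_le_blockSum hK)

theorem SphereRel.coordSpan_star_mul_blockSum (hw : SphereRel w) (hK : 0 < K) :
    coordSpan (fun l => Star.star (w l)) * blockSum w K ≤ blockSum w K := by
  conv_lhs => rw [blockSum]
  rw [Submodule.mul_iSup, iSup_le_iff]
  rintro ⟨s, hs⟩
  set V := coordSpan w
  set V' := coordSpan fun l => Star.star (w l)
  set D := Subalgebra.toSubmodule (blockAlgebra w K) with hD
  have hDD : D * D = D := (Subalgebra.isIdempotentElem_toSubmodule _).eq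
  change V' * (V ^ s * D) ≤ _
  rcases s with _ | s
  -- An adjoint letter lowers the exponent modulo `K`: from `0` it goes to `K - 1`, by inserting `1
  -- ∈ V ^ (K - 1) * V' ^ (K - 1)` on the left and absorbing `V' ^ K` in `D`.
  · refine le_trans ?_ (pow_mul_le_blockSum (Nat.sub_lt hK one_pos))
    calc V' * (V ^ 0 * D) = 1 * (V' * D) := by rw [pow_zero, one_mul, one_mul]
      _ ≤ V ^ (K - 1) * V' ^ (K - 1) * (V' * D) := by gcongr; exact hw.one_le _
      _ = V ^ (K - 1) * (V' ^ (K - 1 + 1) * D) := by rw [pow_succ]; simp only [mul_assoc]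
      _ ≤ V ^ (K - 1) * (D * D) := by
          rw [Nat.sub_add_cancel hK]; gcongr; exact coordSpan_star_pow_le
      _ = _ := by rw [hDD]
  · refine le_trans ?_ (pow_mul_le_blockSum (Nat.lt_of_succ_lt hs))
    -- Here `s + 1 + t = K`. Inserting `1` on both sides of `V'` gathers `s + 1 + t` adjoint letters
    -- followed by `t + (s + 1)` letters, two blocks of length `K`, both absorbed by `D`.
    obtain ⟨t, ht⟩ := Nat.exists_eq_add_of_le hs.le
    calc V' * (V ^ (s + 1) * D) = 1 * V' * 1 * (V ^ (s + 1) * D) := by rw [one_mul, mul_one]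
      _ ≤ (V ^ s * V' ^ s) * V' * (V' ^ t * V ^ t) * (V ^ (s + 1) * D) := by
          gcongr
          · exact hw.one_le _
          · exact hw.one_le_star _
      _ = V ^ s * (V' ^ (s + 1 + t) * (V ^ (t + (s + 1)) * D)) := by
          rw [pow_add V' (s + 1) t, pow_succ V' s, pow_add V t]; simp only [mul_assoc]
      _ ≤ V ^ s * (D * (D * D)) := by
          rw [add_comm t, ← ht]
          gcongr
          · exact coordSpan_star_pow_le
          · exact coordSpan_pow_le
      _ = _ := by rw [hDD, hDD]

theorem SphereRel.adjoin_le_blockSum (hw : SphereRel w) (hK : 0 < K) {x : B}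
    (hx : x ∈ Algebra.adjoin ℂ (Set.range w ∪ Set.range fun l => Star.star (w l))) :
    x ∈ blockSum w K := by
  -- Stability under left multiplication is the statement that passes to sums and products; it is
  -- then applied to `1`.
  suffices ∀ y ∈ blockSum w K, x * y ∈ blockSum w K by
    simpa using this 1 (toSubmodule_le_blockSum hK (one_mem (blockAlgebra w K)))
  induction hx using Algebra.adjoin_induction with
  | mem x hx =>
    intro y hy
    rcases hx with ⟨i, rfl⟩ | ⟨i, rfl⟩
    · exact coordSpan_mul_blockSum hK (Submodule.mul_mem_mul (mem_coordSpan w i) hy)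
    · exact hw.coordSpan_star_mul_blockSum hK
        (Submodule.mul_mem_mul (mem_coordSpan (fun l => Star.star (w l)) i) hy)
  | algebraMap r =>
    intro y hy
    rw [← Algebra.smul_def]
    exact Submodule.smul_mem _ _ hy
  | add x y _ _ hx hy =>
    intro u hu
    rw [add_mul]
    exact add_mem (hx u hu) (hy u hu)
  | mul x y _ _ hx hy =>
    intro u hu
    rw [mul_assoc]
    exact hx _ (hy u hu)

variable {σ : B →⋆ₐ[ℂ] B} {ζ : ℂ}

theorem coordSpan_le_eigen (hσ : ∀ i, σ (w i) = ζ • w i) : coordSpan w ≤ eigen σ ζ := by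
  refine Submodule.span_le.2 ?_
  rintro _ ⟨i, rfl⟩
  exact hσ i

theorem coordSpan_star_le_eigen (hσ : ∀ i, σ (w i) = ζ • w i) :
    coordSpan (fun l => star (w l)) ≤ eigen σ (star ζ) :=
  coordSpan_le_eigen (σ := σ) fun i => star_mem_eigen (mem_eigen.2 (hσ i))

theorem blockAlgebra_le_eigen (hσ : ∀ i, σ (w i) = ζ • w i) (hζ : ζ ^ K = 1) :
    Subalgebra.toSubmodule (blockAlgebra w K) ≤ eigen σ 1 := by
  intro x (hx : x ∈ blockAlgebra w K)
  have h : blockAlgebra w K ≤ AlgHom.equalizer (σ : B →ₐ[ℂ] B) (AlgHom.id ℂ B) := by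
    refine Algebra.adjoin_le ?_
    rintro x (hx | hx)
    · have := pow_le_eigen (coordSpan_le_eigen hσ) K
        ((coordSpan_pow w K).symm ▸ Submodule.subset_span hx)
      rw [hζ] at this
      exact mem_eigen_one.1 this
    · have := pow_le_eigen (coordSpan_star_le_eigen hσ) K
        ((coordSpan_pow (fun l => star (w l)) K).symm ▸ Submodule.subset_span hx)
      rw [← star_pow, hζ, star_one] at this
      exact mem_eigen_one.1 this
  exact mem_eigen_one.2 (h hx)

/-- The summand `V ^ s * D` has degree `s`, so for `0 < s < K` the average kills it, and for `s = 0`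
it is fixed. -/
theorem eigenProj_one_mem_blockAlgebra (hK : K ≠ 0) (hσ : ∀ i, σ (w i) = ζ • w i)
    (hζ : IsPrimitiveRoot ζ K) {x : B} (hx : x ∈ blockSum w K) :
    eigenProj σ K 1 x ∈ blockAlgebra w K := by
  refine (?_ : blockSum w K ≤
    (Subalgebra.toSubmodule (blockAlgebra w K)).comap (eigenProj σ K 1)) hx
  rw [blockSum, iSup_le_iff]
  rintro ⟨s, hs⟩ x (hx : x ∈ coordSpan w ^ s * _)
  have hxe : x ∈ eigen σ (ζ ^ s) := by
    have := (mul_le_mul' (pow_le_eigen (coordSpan_le_eigen hσ) s)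
      (blockAlgebra_le_eigen hσ hζ.pow_eq_one)).trans eigen_mul_le hx
    rwa [mul_one] at this
  rw [Submodule.mem_comap]
  rcases Nat.eq_zero_or_pos s with rfl | h0
  · rw [pow_zero] at hxe
    rw [eigenProj_one_of_mem hK hxe]
    simpa using hx
  · rw [eigenProj_one_eq_zero _ (hζ.pow_ne_one_of_pos_of_lt h0.ne' hs) hxe]
    · exact zero_mem _
    · rw [← pow_mul, mul_comm, pow_mul, hζ.pow_eq_one, one_pow]

end Words

/-! ### Commutativity of the fixed point algebra -/

theorem StarPoly.map_mem_adjoin {B : Type*} [CStarAlgebra B] {N : ℕ} (q : FreeSphere N →⋆ₐ[ℂ] B)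
    (a : StarPoly N) : q (FreeSphere.ofPoly a) ∈ Algebra.adjoin ℂ
      (Set.range (fun i => q (FreeSphere.z i)) ∪ Set.range fun i => star (q (FreeSphere.z i))) := by
  induction a using StarPoly.induct with
  | h1 r =>
    rw [FreeSphere.ofPoly_algebraMap, AlgHomClass.commutes]
    exact Subalgebra.algebraMap_mem _ r
  | h2 x =>
    obtain ⟨i, b⟩ := x
    cases b
    · exact Algebra.subset_adjoin (Or.inl ⟨i, rfl⟩)
    · rw [← FreeSphere.star_z, map_star]
      exact Algebra.subset_adjoin (Or.inr ⟨i, rfl⟩)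
  | h3 a b ha hb => rw [FreeSphere.ofPoly_mul, map_mul]; exact mul_mem ha hb
  | h4 a b ha hb => rw [FreeSphere.ofPoly_add, map_add]; exact add_mem ha hb

namespace FreeSphere

variable {B : Type*} [CStarAlgebra B] {N K : ℕ} {q : FreeSphere N →⋆ₐ[ℂ] B}
  {σ : B →⋆ₐ[ℂ] B} {ζ : ℂ}

theorem _root_.SphereRel.map {A B : Type*} [CStarAlgebra A] [CStarAlgebra B] {w : Fin N → A}
    (hw : SphereRel w) (q : A →⋆ₐ[ℂ] B) : SphereRel fun i => q (w i) := by
  constructor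
  · simpa only [map_sum, map_mul, map_star, map_one] using congrArg q hw.1
  · simpa only [map_sum, map_mul, map_star, map_one] using congrArg q hw.2

/-- Fixed elements equal their averages. Averaging is continuous and sends the dense set of
polynomials into the commutative block algebra, so averages of any two elements commute. -/
theorem commute_of_fixed (hK : K ≠ 0) (hq : Function.Surjective q)
    (hcomm : ∀ a ∈ kCommutators K (fun i => q (z i)), a = 0)
    (hσ : ∀ i, σ (q (z i)) = ζ • q (z i)) (hζ : IsPrimitiveRoot ζ K)
    {x y : B} (hx : x ∈ eigen σ 1) (hy : y ∈ eigen σ 1) : Commute x y := by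
  have hqc : Continuous q := AddMonoidHomClass.continuous_of_bound q 1 fun a => by
    rw [one_mul]; exact NonUnitalStarAlgHom.norm_apply_le q a
  have hd : DenseRange fun a => q (ofPoly a) :=
    hq.denseRange.comp denseRange_ofPoly hqc
  have hE := continuous_eigenProj (σ := σ) K 1
  rw [← eigenProj_one_of_mem hK hx, ← eigenProj_one_of_mem hK hy]
  refine isClosed_property2 hd (p := fun x y => Commute (eigenProj σ K 1 x) (eigenProj σ K 1 y))
    (isClosed_eq (by fun_prop) (by fun_prop)) (fun a b => ?_) x y
  have hm : ∀ a, eigenProj σ K 1 (q (ofPoly a)) ∈ blockAlgebra (fun i => q (z i)) K := fun a =>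
    eigenProj_one_mem_blockAlgebra hK hσ hζ
      (((sphereRel_z N).map q).adjoin_le_blockSum (Nat.pos_of_ne_zero hK)
        (StarPoly.map_mem_adjoin q a))
  exact commute_of_mem_blockAlgebra hcomm (hm a) (hm b)

end FreeSphere

/-! ### Characters of the fixed point algebra and their GNS representations -/

section Characters

open scoped ComplexOrder

variable {B : Type*} [CStarAlgebra B] {σ : B →⋆ₐ[ℂ] B} {K : ℕ} {ζ : ℂ}

/-- A state of `B` extending a character of the commutative fixed point algebra of `σ`. -/
structure IsFixedCharacter (σ : B →⋆ₐ[ℂ] B) (χ : B →ₗ[ℂ] ℂ) : Prop where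
  apply_map : ∀ x, χ (σ x) = χ x
  apply_one : χ 1 = 1
  apply_star : ∀ x, χ (star x) = star (χ x)
  apply_mul : ∀ x ∈ eigen σ 1, ∀ y ∈ eigen σ 1, χ (x * y) = χ x * χ y
  nonneg : ∀ x, star x * x ∈ eigen σ 1 → 0 ≤ χ (star x * x)

/-- The Gelfand transform of the commutative fixed point algebra provides a character `φ` that does
not vanish at `y`; then `χ` is `φ` composed with the average. -/
theorem exists_isFixedCharacter (hK : K ≠ 0) (hσ : ∀ x, σ^[K] x = x)
    (hcomm : ∀ x ∈ eigen σ 1, ∀ y ∈ eigen σ 1, Commute x y) {y : B} (hy : y ∈ eigen σ 1)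
    (hy0 : y ≠ 0) : ∃ χ : B →ₗ[ℂ] ℂ, IsFixedCharacter σ χ ∧ χ y ≠ 0 := by
  let C : StarSubalgebra ℂ B := StarAlgHom.equalizer σ (StarAlgHom.id ℂ B)
  have hC : ∀ x, x ∈ C ↔ x ∈ eigen σ 1 := fun x => mem_eigen_one.symm
  have hcl : IsClosed (C : Set B) := isClosed_eq
    (AddMonoidHomClass.continuous_of_bound σ 1 fun a => by
      rw [one_mul]; exact NonUnitalStarAlgHom.norm_apply_le σ a) continuous_id
  let _ : CommCStarAlgebra C :=
    { StarSubalgebra.cstarAlgebra C with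
      mul_comm := fun a b =>
        Subtype.ext (hcomm a ((hC _).1 a.2) b ((hC _).1 b.2)).eq }
  have hg := (gelfandTransform_isometry C).injective
  obtain ⟨φ, hφ⟩ : ∃ φ : WeakDual.characterSpace ℂ C, φ ⟨y, (hC y).2 hy⟩ ≠ 0 := by
    by_contra! h
    have h0 : (⟨y, (hC y).2 hy⟩ : C) = 0 := hg <| by
      rw [map_zero]
      exact ContinuousMap.ext h
    exact hy0 (congrArg Subtype.val h0)
  have hE : ∀ x, eigenProj σ K 1 x ∈ C := fun x =>
    (hC _).2 (eigenProj_mem hσ (one_pow K) hK)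
  have hfix : ∀ {x} (hx : x ∈ eigen σ 1), (⟨eigenProj σ K 1 x, hE x⟩ : C) = ⟨x, (hC x).2 hx⟩ :=
    fun hx => Subtype.ext (eigenProj_one_of_mem hK hx)
  let χ : B →ₗ[ℂ] ℂ :=
    { toFun := fun x => φ ⟨eigenProj σ K 1 x, hE x⟩
      map_add' := fun a b => by
        rw [← map_add]; congr 1; exact Subtype.ext (map_add _ a b)
      map_smul' := fun c a => by
        rw [RingHom.id_apply, ← map_smul]; congr 1; exact Subtype.ext (map_smul _ c a) }
  have hχ : ∀ x, χ x = φ ⟨eigenProj σ K 1 x, hE x⟩ := fun x => rfl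
  have h1 : (1 : B) ∈ eigen σ 1 := mem_eigen_one.2 (map_one σ)
  refine ⟨χ, ⟨fun x => ?_, ?_, fun x => ?_, fun x hx y hy => ?_, fun x hx => ?_⟩, ?_⟩
  · rw [hχ, hχ]; congr 1; exact Subtype.ext (eigenProj_one_map hσ x)
  · rw [hχ, hfix h1]; exact map_one φ
  · rw [hχ, hχ, ← map_star]; congr 1; exact Subtype.ext (star_eigenProj_one K x)
  · have hxy : x * y ∈ eigen σ 1 := by simpa using mul_mem_eigen hx hy
    rw [hχ, hχ, hχ, hfix hx, hfix hy, hfix hxy, ← map_mul]; rfl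
  · let _ := CStarAlgebra.spectralOrder B
    have _ := CStarAlgebra.spectralOrderedRing B
    rw [hχ, hfix hx]
    -- The value of a character lies in the spectrum, which is the same in the fixed point algebra
    -- and in `B`, where positivity of `x⋆x` applies.
    have hs : φ ⟨star x * x, (hC _).2 hx⟩ ∈ spectrum ℂ (⟨star x * x, (hC _).2 hx⟩ : C) :=
      AlgHom.apply_mem_spectrum φ _
    rw [StarSubalgebra.spectrum_eq C] at hs
    exact spectrum_nonneg_of_nonneg (star_mul_self_nonneg x) hs
  · rw [hχ, hfix hy]; exact hφ

namespace IsFixedCharacter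

variable {χ : B →ₗ[ℂ] ℂ} (hχ : IsFixedCharacter σ χ)
include hχ

theorem eq_zero_of_mem_eigen {c : ℂ} (hc : c ≠ 1) {x : B} (hx : x ∈ eigen σ c) : χ x = 0 := by
  have h := hχ.apply_map x
  rw [mem_eigen.1 hx, map_smul, smul_eq_mul] at h
  have : (c - 1) * χ x = 0 := by rw [sub_mul, h, one_mul, sub_self]
  exact (mul_eq_zero.1 this).resolve_left (sub_ne_zero.2 hc)

variable (hcomm : ∀ x ∈ eigen σ 1, ∀ y ∈ eigen σ 1, Commute x y)
include hcomm

/-- The rank one identity seen through `χ`: for the form `χ(x⋆y)`, an eigenspace modulo null vectors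
has dimension at most one. -/
theorem star_mul_mul {c : ℂ} (hc : star c * c = 1) {x b y : B} (hx : x ∈ eigen σ c)
    (hb : b ∈ eigen σ c) (hy : y ∈ eigen σ c) :
    χ (star x * b) * χ (star b * y) = χ (star x * y) * χ (star b * b) := by
  have h1 : ∀ x ∈ eigen σ c, ∀ y ∈ eigen σ c, star x * y ∈ eigen σ 1 := fun x hx y hy => by
    simpa only [hc] using mul_mem_eigen (star_mem_eigen hx) hy
  have h2 : ∀ x ∈ eigen σ c, ∀ y ∈ eigen σ c, x * star y ∈ eigen σ 1 := fun x hx y hy => by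
    simpa only [mul_comm c, hc] using mul_mem_eigen hx (star_mem_eigen hy)
  rw [← hχ.apply_mul _ (h1 x hx b hb) _ (h1 b hb y hy), ← hχ.apply_mul _ (h1 x hx y hy) _ (h1 b hb b hb),
    star_mul_mul_star_mul (H := eigen σ c) _ hx hb hy]
  exact fun x hx y hy z hz w hw =>
    ⟨hcomm _ (h1 x hx y hy) _ (h1 z hz w hw), hcomm _ (h2 x hx y hy) _ (h2 z hz w hw)⟩

/-- A nonzero spectral subspace contains a unit vector for the state `χ`. -/
theorem exists_unit {c : ℂ} (hc : star c * c = 1) {V' V : Submodule ℂ B}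
    (hV' : V' ≤ eigen σ (star c)) (hV : V ≤ eigen σ c) (h1 : 1 ≤ V' * V) :
    ∃ b ∈ eigen σ c, χ (star b * b) = 1 := by
  have hfix : ∀ b ∈ eigen σ c, star b * b ∈ eigen σ 1 := fun b hb => by
    simpa only [hc] using mul_mem_eigen (star_mem_eigen hb) hb
  -- If the form had zero diagonal on the eigenspace, the rank one identity would give `|χ(x⋆y)|² =
  -- 0` for all `x`, `y` there. Then `χ` would vanish on `V' * V`, which contains `1`.
  obtain ⟨b, hb, hb0⟩ : ∃ b ∈ eigen σ c, χ (star b * b) ≠ 0 := by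
    by_contra! h
    have h0 : ∀ x ∈ eigen σ c, ∀ y ∈ eigen σ c, χ (star x * y) = 0 := fun x hx y hy => by
      have := hχ.star_mul_mul hcomm hc hx hy hx
      rw [h x hx, zero_mul] at this
      have hs : χ (star y * x) = star (χ (star x * y)) := by
        rw [← hχ.apply_star, star_mul, star_star]
      rw [hs] at this
      rcases mul_eq_zero.1 this with h | h
      · exact h
      · exact star_eq_zero.1 h
    have : V' * V ≤ LinearMap.ker χ := Submodule.mul_le.2 fun x hx y hy => by
      have hx' : star x ∈ eigen σ c := by simpa using star_mem_eigen (hV' hx)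
      simpa using h0 _ hx' y (hV hy)
    have h := this (Submodule.one_le.1 h1)
    rw [LinearMap.mem_ker, hχ.apply_one] at h
    exact one_ne_zero h
  obtain ⟨hre, him⟩ := Complex.nonneg_iff.1 (hχ.nonneg b (hfix b hb))
  set t : ℝ := (χ (star b * b)).re with ht
  have htt : χ (star b * b) = (t : ℂ) := Complex.ext rfl (by rw [← him, Complex.ofReal_im])
  have ht0 : t ≠ 0 := fun h => hb0 (by rw [htt, h, Complex.ofReal_zero])
  refine ⟨((√t)⁻¹ : ℂ) • b, Submodule.smul_mem _ _ hb, ?_⟩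
  rw [star_smul, smul_mul_smul_comm, map_smul, htt, Complex.star_def, map_inv₀, Complex.conj_ofReal,
    ← mul_inv, ← Complex.ofReal_mul, Real.mul_self_sqrt hre, smul_eq_mul,
    inv_mul_cancel₀ (Complex.ofReal_ne_zero.2 ht0)]

/-- Parseval's identity: distinct eigenspaces are orthogonal for `χ`, and each is spanned by its
unit vector `b e` modulo null vectors. By linearity `x` and `y` may be taken homogeneous. -/
theorem sum_star_mul_mul (hK : K ≠ 0) (hζ : IsPrimitiveRoot ζ K) (hσ : ∀ x, σ^[K] x = x)
    {b : Fin K → B} (hb : ∀ e : Fin K, b e ∈ eigen σ (ζ ^ (e : ℕ))) (hb1 : ∀ e, χ (star (b e) * b e) = 1)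
    (x y : B) : ∑ e, χ (star x * b e) * χ (star (b e) * y) = χ (star x * y) := by
  have hζ1 : star ζ = ζ⁻¹ := by
    rw [Complex.star_def, Complex.inv_def, Complex.normSq_eq_norm_sq, hζ.norm'_eq_one hK]
    simp
  have hζ0 : ζ ≠ 0 := hζ.ne_zero hK
  have hu : ∀ e : ℕ, star (ζ ^ e) * ζ ^ e = 1 := fun e => by
    rw [star_pow, hζ1, ← mul_pow, inv_mul_cancel₀ hζ0, one_pow]
  have horth : ∀ {d e : Fin K} {x y : B}, d ≠ e → x ∈ eigen σ (ζ ^ (d : ℕ)) →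
      y ∈ eigen σ (ζ ^ (e : ℕ)) → χ (star x * y) = 0 := fun {d e x y} hde hx hy => by
    refine hχ.eq_zero_of_mem_eigen (fun h => hde ?_) (mul_mem_eigen (star_mem_eigen hx) hy)
    have h2 : ζ ^ (d : ℕ) = ζ ^ (e : ℕ) := by
      rw [← mul_one (ζ ^ (d : ℕ)), ← h, mul_left_comm, ← mul_assoc, hu, one_mul]
    exact Fin.ext (hζ.pow_inj d.2 e.2 h2)
  have htop := iSup_eigen_eq_top hK hζ hσ
  have hx : x ∈ ⨆ e : Fin K, eigen σ (ζ ^ (e : ℕ)) := htop ▸ Submodule.mem_top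
  have hy : y ∈ ⨆ e : Fin K, eigen σ (ζ ^ (e : ℕ)) := htop ▸ Submodule.mem_top
  induction hx using Submodule.iSup_induction' with
  | zero => simp
  | add x x' _ _ h h' =>
    simp only [star_add, add_mul, map_add, Finset.sum_add_distrib, h, h']
  | mem d x hx =>
    induction hy using Submodule.iSup_induction' with
    | zero => simp
    | add y y' _ _ h h' =>
      simp only [mul_add, map_add, Finset.sum_add_distrib, h, h']
    | mem e y hy =>
      rw [Finset.sum_eq_single d]
      · rcases eq_or_ne d e with rfl | hde
        · rw [hχ.star_mul_mul hcomm (hu _) hx (hb _) hy, hb1, mul_one]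
        · rw [horth hde (hb d) hy, horth hde hx hy, mul_zero]
      · intro f _ hf
        rw [horth hf.symm hx (hb f), zero_mul]
      · exact fun h => (h (Finset.mem_univ d)).elim

/-- The `K`-dimensional representation of `B` attached to a character of the fixed point algebra. -/
theorem exists_matrix_rep (hK : K ≠ 0) (hζ : IsPrimitiveRoot ζ K) (hσ : ∀ x, σ^[K] x = x)
    {b : Fin K → B} (hb : ∀ e : Fin K, b e ∈ eigen σ (ζ ^ (e : ℕ)))
    (hb1 : ∀ e, χ (star (b e) * b e) = 1) :
    ∃ ρ : B →⋆ₐ[ℂ] CStarMatrix (Fin K) (Fin K) ℂ, ∀ a r c, ρ a r c = χ (star (b r) * a * b c) := by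
  have hone : ∀ r c, χ (star (b r) * b c) = if r = c then 1 else 0 := fun r c => by
    split_ifs with h
    · rw [h, hb1]
    -- Parseval for `b r`: the nonnegative terms `|χ(b_r⋆ b_e)|²` add up to `1`, already reached by
    -- `e = r`, so all others vanish.
    · have hs := hχ.sum_star_mul_mul hcomm hK hζ hσ hb hb1 (b r) (b r)
      rw [← Finset.add_sum_erase _ _ (Finset.mem_univ r), hb1, mul_one, add_eq_left] at hs
      have hs' : ∀ e, χ (star (b r) * b e) * χ (star (b e) * b r)
          = ((‖χ (star (b r) * b e)‖ ^ 2 : ℝ) : ℂ) := fun e => by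
        have : χ (star (b e) * b r) = star (χ (star (b r) * b e)) := by
          rw [← hχ.apply_star, star_mul, star_star]
        rw [this, Complex.star_def, Complex.mul_conj, Complex.normSq_eq_norm_sq]
      simp only [hs'] at hs
      rw [← Complex.ofReal_sum, Complex.ofReal_eq_zero,
        Finset.sum_eq_zero_iff_of_nonneg fun _ _ => sq_nonneg _] at hs
      have := hs c (Finset.mem_erase.2 ⟨Ne.symm h, Finset.mem_univ c⟩)
      exact norm_eq_zero.1 (pow_eq_zero_iff two_ne_zero |>.1 this)
  refine ⟨StarAlgHom.mk (AlgHom.ofLinearMap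
    { toFun := fun a => CStarMatrix.ofMatrix (Matrix.of fun r c => χ (star (b r) * a * b c))
      map_add' := fun x y => ?_
      map_smul' := fun x y => ?_ } ?_ ?_) ?_, fun a r c => rfl⟩
  · ext r c
    change χ _ = χ _ + χ _
    rw [mul_add, add_mul, map_add]
  · ext r c
    change χ _ = x • χ _
    rw [mul_smul_comm, smul_mul_assoc, map_smul]
  · ext r c
    change χ _ = _
    rw [mul_one, hone, CStarMatrix.one_apply]
  · intro x y
    ext r c
    rw [CStarMatrix.mul_apply]
    change χ _ = ∑ e, χ _ * χ _
    -- Multiplicativity is Parseval's identity for the vectors `x⋆ b_r` and `y b_c`.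
    have := hχ.sum_star_mul_mul hcomm hK hζ hσ hb hb1 (star x * b r) (y * b c)
    simp only [star_mul, star_star, ← mul_assoc] at this ⊢
    exact this.symm
  · intro x
    ext r c
    rw [CStarMatrix.star_apply]
    change χ _ = star (χ _)
    rw [← hχ.apply_star]
    simp only [star_mul, star_star, mul_assoc]

end IsFixedCharacter

end Characters

/-! ### Factorization of morphisms and matrices over C⋆-algebras -/

/-- A morphism vanishing on the kernel of a surjective morphism factorizes through it. -/
theorem StarAlgHom.exists_factor {A B C : Type*} [Ring A] [StarRing A] [Algebra ℂ A] [Ring B]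
    [StarRing B] [Algebra ℂ B] [Ring C] [StarRing C] [Algebra ℂ C] {q : A →⋆ₐ[ℂ] B}
    (hq : Function.Surjective q) (g : A →⋆ₐ[ℂ] C) (h : ∀ a, q a = 0 → g a = 0) :
    ∃ f : B →⋆ₐ[ℂ] C, ∀ a, f (q a) = g a := by
  have hg : ∀ a b, q a = q b → g a = g b := fun a b hab => by
    rw [← sub_eq_zero, ← map_sub]
    exact h _ (by rw [map_sub, hab, sub_self])
  let s := Function.surjInv hq
  have hs : ∀ b, q (s b) = b := Function.surjInv_eq hq
  have hf : ∀ a, g (s (q a)) = g a := fun a => hg _ _ (hs _)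
  refine ⟨{ toFun := fun b => g (s b)
            map_one' := ?_
            map_mul' := ?_
            map_zero' := ?_
            map_add' := ?_
            commutes' := ?_
            map_star' := ?_ }, hf⟩
  · rw [← map_one q, hf, map_one]
  · intro x y
    rw [← map_mul]
    exact hg _ _ (by rw [map_mul, hs, hs, hs])
  · change g (s 0) = 0
    rw [← map_zero q, hf, map_zero]
  · intro x y
    change g (s (x + y)) = g (s x) + g (s y)
    rw [← map_add]
    exact hg _ _ (by rw [map_add, hs, hs, hs])
  · intro c
    change g (s (algebraMap ℂ B c)) = _
    rw [← AlgHomClass.commutes q, hf, AlgHomClass.commutes]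
  · intro x
    rw [← map_star]
    exact hg _ _ (by rw [map_star, hs, hs])

/-- Application of a morphism to the entries of a matrix, followed by a permutation of the
indices. -/
def CStarMatrix.mapPerm {n A B : Type*} [Fintype n] [DecidableEq n] [CStarAlgebra A]
    [CStarAlgebra B] (f : A →⋆ₐ[ℂ] B) (s : Equiv.Perm n) :
    CStarMatrix n n A →⋆ₐ[ℂ] CStarMatrix n n B where
  toFun M := CStarMatrix.ofMatrix (Matrix.of fun i j => f (M (s i) (s j)))
  map_one' := by
    ext i j
    change f _ = _
    rw [CStarMatrix.one_apply, CStarMatrix.one_apply]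
    by_cases h : i = j <;> simp [h]
  map_mul' M M' := by
    ext i j
    rw [CStarMatrix.mul_apply]
    change f _ = ∑ k, f _ * f _
    rw [CStarMatrix.mul_apply, map_sum, ← Equiv.sum_comp s]
    simp only [map_mul]
  map_zero' := by
    ext i j
    exact map_zero f
  map_add' M M' := by
    ext i j
    exact map_add f _ _
  commutes' c := by
    ext i j
    change f _ = _
    rw [CStarMatrix.algebraMap_apply, CStarMatrix.algebraMap_apply]
    by_cases h : i = j <;> simp [h, AlgHomClass.commutes]
  map_star' M := by
    ext i j
    exact map_star f _

theorem CStarMatrix.mapPerm_apply {n A B : Type*} [Fintype n] [DecidableEq n] [CStarAlgebra A]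
    [CStarAlgebra B] (f : A →⋆ₐ[ℂ] B) (s : Equiv.Perm n) (M : CStarMatrix n n A) (i j : n) :
    mapPerm f s M i j = f (M (s i) (s j)) := rfl

/-- Matrices over a C⋆-algebra form a C⋆-algebra. -/
instance CStarMatrix.cstarAlgebraSpectral {n A : Type*} [Fintype n] [DecidableEq n]
    [CStarAlgebra A] : CStarAlgebra (CStarMatrix n n A) :=
  letI := CStarAlgebra.spectralOrder A
  letI := CStarAlgebra.spectralOrderedRing A
  CStarMatrix.instCStarAlgebra

theorem CStarMatrix.sum_apply {n ι A : Type*} [Fintype n] [DecidableEq n] [CStarAlgebra A]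
    (s : Finset ι) (M : ι → CStarMatrix n n A) (i j : n) : (∑ k ∈ s, M k) i j = ∑ k ∈ s, M k i j :=
  map_sum (⟨⟨fun M => M i j, rfl⟩, fun _ _ => rfl⟩ : CStarMatrix n n A →+ A) M s

/-! ### The cyclic shift model and its model space -/

section Model

variable (N K : ℕ)

/-- The weighted cyclic shifts with weights the coordinates on `(S^{N-1}_ℂ)^K`. -/
def shiftMatrix (i : Fin N) : CStarMatrix (Fin K) (Fin K) C(SpherePow N K, ℂ) :=
  CStarMatrix.ofMatrix <| Matrix.of fun r c => if r = finRotate K c then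
    ⟨fun x => (x c).1 i, by fun_prop⟩ else 0

variable {N K}

theorem shiftMatrix_apply (i : Fin N) (r c : Fin K) (x : SpherePow N K) :
    shiftMatrix N K i r c x = if r = finRotate K c then (x c).1 i else 0 := by
  change (if r = finRotate K c then (_ : C(SpherePow N K, ℂ)) else 0) x = _
  split_ifs <;> rfl

theorem sum_coord_mul_star (x : Metric.sphere (0 : EuclideanSpace ℂ (Fin N)) 1) :
    ∑ i, x.1 i * star (x.1 i) = 1 := by
  have h := EuclideanSpace.norm_sq_eq x.1
  rw [norm_eq_of_mem_sphere, one_pow] at h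
  simp only [Complex.star_def, Complex.mul_conj, Complex.normSq_eq_norm_sq]
  rw [← Complex.ofReal_sum, ← h, Complex.ofReal_one]

/-- Each row and each column of a shift has a single possibly nonzero entry, so off-diagonal entries
vanish and every diagonal entry is the squared norm of one of the points. -/
theorem sphereRel_shiftMatrix : SphereRel (shiftMatrix N K) := by
  constructor
  · refine CStarMatrix.ext fun r c => ContinuousMap.ext fun x => ?_
    simp only [CStarMatrix.sum_apply, CStarMatrix.mul_apply, CStarMatrix.star_apply,
      ContinuousMap.sum_apply, ContinuousMap.mul_apply, ContinuousMap.star_apply,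
      shiftMatrix_apply]
    obtain ⟨d, rfl⟩ := (finRotate K).surjective r
    rw [Finset.sum_comm, Finset.sum_eq_single d]
    · by_cases h : c = finRotate K d
      · subst h
        simpa only [if_true, CStarMatrix.one_apply_eq, ContinuousMap.one_apply] using sum_coord_mul_star (x d)
      · simp only [if_true, if_neg h, star_zero, mul_zero, Finset.sum_const_zero,
          CStarMatrix.one_apply_ne (Ne.symm h), ContinuousMap.zero_apply]
    · intro e _ he
      refine Finset.sum_eq_zero fun i _ => ?_
      rw [if_neg fun h => he ((finRotate K).injective h.symm), zero_mul]
    · exact fun h => (h (Finset.mem_univ _)).elim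
  · refine CStarMatrix.ext fun r c => ContinuousMap.ext fun x => ?_
    simp only [CStarMatrix.sum_apply, CStarMatrix.mul_apply, CStarMatrix.star_apply,
      ContinuousMap.sum_apply, ContinuousMap.mul_apply, ContinuousMap.star_apply,
      shiftMatrix_apply]
    rw [Finset.sum_comm, Finset.sum_eq_single (finRotate K c)]
    · by_cases h : r = c
      · subst h
        simpa [CStarMatrix.one_apply, mul_comm] using sum_coord_mul_star (x r)
      · simp [h, Ne.symm h]
    · intro e _ he
      refine Finset.sum_eq_zero fun i _ => ?_
      rw [if_neg he, mul_zero]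
    · exact fun h => (h (Finset.mem_univ _)).elim

variable (N K)

/-- The universal cyclic shift model of the free sphere. -/
def shiftModel : FreeSphere N →⋆ₐ[ℂ] CStarMatrix (Fin K) (Fin K) C(SpherePow N K, ℂ) :=
  FreeSphere.lift sphereRel_shiftMatrix

variable {N K}

theorem shiftModel_z (i : Fin N) : shiftModel N K (FreeSphere.z i) = shiftMatrix N K i :=
  FreeSphere.lift_z _ i

/-- Permuting the points cyclically amounts to conjugating by a permutation matrix. Both sides come
from morphisms on the free sphere, so it suffices to compare them on coordinates. -/
theorem shiftModel_apply_rotate (p : FreeSphere N) (r c : Fin K) (x : SpherePow N K) :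
    shiftModel N K p r c (x ∘ finRotate K) = shiftModel N K p (finRotate K r) (finRotate K c) x := by
  let ρ : C(SpherePow N K, SpherePow N K) := ⟨fun x => x ∘ finRotate K, by fun_prop⟩
  have h : (CStarMatrix.mapPerm (ρ.compStarAlgHom' ℂ ℂ) (Equiv.refl _)).comp (shiftModel N K) =
      (CStarMatrix.mapPerm (StarAlgHom.id ℂ C(SpherePow N K, ℂ)) (finRotate K)).comp
        (shiftModel N K) := by
    refine FreeSphere.hom_ext fun i => ?_
    ext r c x
    simp only [StarAlgHom.comp_apply, shiftModel_z, CStarMatrix.mapPerm_apply]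
    change shiftMatrix N K i r c (x ∘ finRotate K)
      = shiftMatrix N K i (finRotate K r) (finRotate K c) x
    simp [shiftMatrix_apply]
  exact DFunLike.congr_fun (congrFun (congrFun (DFunLike.congr_fun h p) r) c) x

variable {B : Type*} [CStarAlgebra B] (q : FreeSphere N →⋆ₐ[ℂ] B)

variable (K) in
/-- The points of `(S^{N-1}_ℂ)^K` whose cyclic shift model factorizes through `q`. -/
def modelSpace : Set (SpherePow N K) :=
  {x | ∀ p, q p = 0 → ∀ r c, shiftModel N K p r c x = 0}

theorem isCompact_modelSpace : IsCompact (modelSpace K q) := by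
  refine IsClosed.isCompact ?_
  simp only [modelSpace, Set.ofPred_forall]
  exact isClosed_iInter fun p => isClosed_iInter fun _ => isClosed_iInter fun r =>
    isClosed_iInter fun c => isClosed_eq (map_continuous _) continuous_const

theorem isCyclicSymmetric_modelSpace : IsCyclicSymmetric (modelSpace K q) := fun x hx p hp r c => by
  rw [shiftModel_apply_rotate]
  exact hx p hp _ _

variable {q}

/-- The cyclic shift model of a closed subspace of the free sphere, on its model space. -/
theorem exists_matrixModel (hq : Function.Surjective q) :
    ∃ π : B →⋆ₐ[ℂ] Matrix (Fin K) (Fin K) C(modelSpace K q, ℂ),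
      ∀ p r c (x : modelSpace K q), π (q p) r c x = shiftModel N K p r c x := by
  have hT : CompactSpace (modelSpace K q) := isCompact_iff_compactSpace.1 (isCompact_modelSpace q)
  let ι : C(modelSpace K q, SpherePow N K) := ⟨Subtype.val, continuous_subtype_val⟩
  obtain ⟨π, hπ⟩ := StarAlgHom.exists_factor hq
    ((CStarMatrix.ofMatrixStarAlgEquiv (n := Fin K) (A := C(modelSpace K q, ℂ))).symm.toStarAlgHom.comp
      ((CStarMatrix.mapPerm (ι.compStarAlgHom' ℂ ℂ) (Equiv.refl _)).comp (shiftModel N K)))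
    fun p hp => by
      ext r c x
      exact x.2 p hp r c
  exact ⟨π, fun p r c x => DFunLike.congr_fun (congrFun (congrFun (hπ p) r) c) x⟩

/-- A representation by weighted cyclic shifts is given by a point of the model space. -/
theorem exists_mem_modelSpace (ρ : B →⋆ₐ[ℂ] CStarMatrix (Fin K) (Fin K) ℂ)
    (hρ : ∀ i r c, r ≠ finRotate K c → ρ (q (FreeSphere.z i)) r c = 0) :
    ∃ x ∈ modelSpace K q, ∀ p r c, ρ (q p) r c = shiftModel N K p r c x := by
  -- The `c`-th point collects the only possibly nonzero entries of column `c`; it has norm one by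
  -- the `(c, c)` entry of `∑ z_i⋆ z_i = 1`.
  have hs : ∀ c, (WithLp.toLp 2 fun i => ρ (q (FreeSphere.z i)) (finRotate K c) c) ∈
      Metric.sphere (0 : EuclideanSpace ℂ (Fin N)) 1 := fun c => by
    have h := ((FreeSphere.sphereRel_z N).map (ρ.comp q)).2
    have h := congrFun (congrFun h c) c
    rw [CStarMatrix.sum_apply, CStarMatrix.one_apply_eq] at h
    have h1 : ∀ i, (star (ρ.comp q (FreeSphere.z i)) * ρ.comp q (FreeSphere.z i)) c c
        = ((‖ρ (q (FreeSphere.z i)) (finRotate K c) c‖ ^ 2 : ℝ) : ℂ) := fun i => by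
      rw [CStarMatrix.mul_apply, Finset.sum_eq_single (finRotate K c), CStarMatrix.star_apply]
      · change star (ρ (q _) _ _) * ρ (q _) _ _ = _
        rw [Complex.star_def, mul_comm, Complex.mul_conj, Complex.normSq_eq_norm_sq]
      · intro e _ he
        change _ * ρ (q _) _ _ = _
        rw [hρ i e c he, mul_zero]
      · exact fun h => (h (Finset.mem_univ _)).elim
    simp only [h1] at h
    rw [← Complex.ofReal_sum, Complex.ofReal_eq_one] at h
    rw [mem_sphere_zero_iff_norm, EuclideanSpace.norm_eq, Real.sqrt_eq_one]
    exact h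
  let x : SpherePow N K := fun c => ⟨_, hs c⟩
  have h : ρ.comp q = (CStarMatrix.mapPerm (ContinuousMap.evalStarAlgHom ℂ ℂ x)
      (Equiv.refl _)).comp (shiftModel N K) := by
    refine FreeSphere.hom_ext fun i => ?_
    ext r c
    simp only [StarAlgHom.comp_apply, shiftModel_z, CStarMatrix.mapPerm_apply]
    change _ = shiftMatrix N K i r c x
    rw [shiftMatrix_apply]
    split_ifs with hrc
    · rw [hrc]
    · exact hρ i r c hrc
  have h' : ∀ p r c, ρ (q p) r c = shiftModel N K p r c x := fun p r c =>
    congrFun (congrFun (DFunLike.congr_fun h p) r) c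
  refine ⟨x, fun p hp r c => ?_, h'⟩
  rw [← h', hp, map_zero]
  rfl

end Model

/-! ### Generated ideals, preimages and inclusions of subspaces -/

namespace ClosedIdeal

variable {A : Type*} [CStarAlgebra A]

theorem subset_span (S : Set A) : S ⊆ (span S).toIdeal := fun _ hx =>
  Submodule.mem_sInf.2 fun _ hI => hI.2.2 hx

theorem span_le {S : Set A} {I : ClosedIdeal A} (h : S ⊆ I.toIdeal) :
    (span S).toIdeal ≤ I.toIdeal :=
  sInf_le ⟨fun _ hx y => I.mul_mem_right y hx, I.isClosed, h⟩

/-- The preimage of a closed ideal by a morphism. -/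
def comap {B : Type*} [CStarAlgebra B] (f : A →⋆ₐ[ℂ] B) (I : ClosedIdeal B) : ClosedIdeal A where
  toIdeal := I.toIdeal.comap f
  mul_mem_right y hx := by
    rw [Ideal.mem_comap] at *
    rw [map_mul]
    exact I.mul_mem_right _ hx
  isClosed := I.isClosed.preimage (AddMonoidHomClass.continuous_of_bound f 1 fun a => by
    rw [one_mul]; exact NonUnitalStarAlgHom.norm_apply_le f a)

theorem subspaceIncl {I J : ClosedIdeal A} (h : J.toIdeal ≤ I.toIdeal) : SubspaceIncl I J := by
  obtain ⟨f, hf⟩ := StarAlgHom.exists_factor J.quotMap_surjective I.quotMap fun a ha =>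
    I.quotMap_eq_zero_iff.2 (h (J.quotMap_eq_zero_iff.1 ha))
  refine ⟨f, fun x => ?_, hf⟩
  obtain ⟨a, rfl⟩ := I.quotMap_surjective x
  exact ⟨J.quotMap a, hf a⟩

end ClosedIdeal

/-! ### The rotation on the `1/K`-classical version -/

section Rotation

variable {A : Type*} [CStarAlgebra A] {N K : ℕ}

theorem orderedProd_smul (c : ℂ) (x : Fin N → A) (i : Fin K → Fin N) :
    orderedProd (fun l => c • x l) i = c ^ K • orderedProd x i := by
  have h : ∀ l : List A, (l.map (c • ·)).prod = c ^ l.length • l.prod := fun l => by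
    induction l with
    | nil => simp
    | cons a l ih => simp [ih, pow_succ', smul_smul, mul_comm]
  have := h (List.ofFn fun c => x (i c))
  rwa [List.map_ofFn, List.length_ofFn] at this

theorem map_orderedProd {B : Type*} [CStarAlgebra B] (f : A →⋆ₐ[ℂ] B) (x : Fin N → A)
    (i : Fin K → Fin N) : f (orderedProd x i) = orderedProd (fun l => f (x l)) i := by
  rw [orderedProd, map_list_prod, List.map_ofFn]
  rfl

/-- The rotation by a primitive root of unity acts on the `1/K`-classical version. -/
theorem exists_rotation {q : FreeSphere N →⋆ₐ[ℂ] A} (hsym : IsKSymmetric K q)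
    (ω : rootsOfUnity K Circle) :
    ∃ σ : (kClassIdeal K q).Quot →⋆ₐ[ℂ] (kClassIdeal K q).Quot,
      ∀ i, σ ((kClassIdeal K q).quotMap (q (FreeSphere.z i))) =
        (((ω : Circleˣ) : Circle) : ℂ) • (kClassIdeal K q).quotMap (q (FreeSphere.z i)) := by
  obtain ⟨ρ, hρ⟩ := hsym
  set I := kClassIdeal K q
  set ζ : ℂ := (((ω : Circleˣ) : Circle) : ℂ) with hζ
  have hζK : ζ ^ K = 1 := by
    rw [hζ, ← Circle.coe_pow, ← Units.val_pow_eq_pow_val, (mem_rootsOfUnity K _).1 ω.2,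
      Units.val_one, Circle.coe_one]
  have hz : ∀ i, ρ ω (q (FreeSphere.z i)) = ζ • q (FreeSphere.z i) := fun i => by
    rw [hρ, FreeSphere.rotate_z, map_smul]
  let f : A →⋆ₐ[ℂ] A := (ρ ω).toStarAlgHom
  have hf : ∀ a, f a = ρ ω a := fun _ => rfl
  have h1 : ∀ i : Fin K → Fin N, f (orderedProd (fun i => q (FreeSphere.z i)) i) =
      orderedProd (fun i => q (FreeSphere.z i)) i := fun i => by
    rw [map_orderedProd]
    simp only [hf, hz]
    rw [orderedProd_smul, hζK, one_smul]
  have h2 : ∀ i : Fin K → Fin N, f (orderedProd (fun i => star (q (FreeSphere.z i))) i) =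
      orderedProd (fun i => star (q (FreeSphere.z i))) i := fun i => by
    rw [map_orderedProd]
    simp only [map_star, hf, hz, star_smul]
    rw [orderedProd_smul, ← star_pow, hζK, star_one, one_smul]
  -- Rotation multiplies a word of length `K` by `ζ ^ K = 1`, so it fixes every generating
  -- commutator and preserves the ideal.
  have hle : I.toIdeal ≤ (I.comap f).toIdeal := by
    refine ClosedIdeal.span_le fun a ha => ?_
    have hfa : f a = a := by
      obtain ⟨i, j, rfl | rfl⟩ := ha
      · simp only [map_sub, map_mul, h1]
      · simp only [map_sub, map_mul, h1, h2]
    change f a ∈ I.toIdeal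
    rw [hfa]
    exact ClosedIdeal.subset_span _ ha
  obtain ⟨σ, hσ⟩ := StarAlgHom.exists_factor I.quotMap_surjective (I.quotMap.comp f) fun a ha =>
    I.quotMap_eq_zero_iff.2 (hle (I.quotMap_eq_zero_iff.1 ha))
  refine ⟨σ, fun i => ?_⟩
  rw [hσ, StarAlgHom.comp_apply, hf, hz, map_smul]

end Rotation

/-! ### Separation by shift representations and the main theorem -/

/-- The representations by weighted cyclic shifts separate the points of a quotient of the free
sphere algebra satisfying the `K`-half-liberation relations, with an action of a primitive `K`-th
root of unity by rotation. -/
theorem eq_zero_of_shiftModel {B : Type*} [CStarAlgebra B] {N K : ℕ} {q : FreeSphere N →⋆ₐ[ℂ] B}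
    (hK : K ≠ 0) (hq : Function.Surjective q)
    (hcomm : ∀ a ∈ kCommutators K (fun i => q (FreeSphere.z i)), a = 0) {ζ : ℂ}
    (hζ : IsPrimitiveRoot ζ K) {σ : B →⋆ₐ[ℂ] B}
    (hσz : ∀ i, σ (q (FreeSphere.z i)) = ζ • q (FreeSphere.z i)) {p : FreeSphere N}
    (hp : ∀ x ∈ modelSpace K q, ∀ r c, shiftModel N K p r c x = 0) : q p = 0 := by
  have hσ : ∀ x, σ^[K] x = x := by
    have hit : ∀ k : ℕ, ∃ f : B →⋆ₐ[ℂ] B, (∀ x, f x = σ^[k] x) ∧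
        ∀ i, f (q (FreeSphere.z i)) = ζ ^ k • q (FreeSphere.z i) := fun k => by
      induction k with
      | zero => exact ⟨StarAlgHom.id ℂ B, fun x => rfl, fun i => by simp⟩
      | succ k ih =>
        obtain ⟨f, hf, hfz⟩ := ih
        refine ⟨σ.comp f, fun x => ?_, fun i => ?_⟩
        · rw [StarAlgHom.comp_apply, hf, Function.iterate_succ_apply']
        · rw [StarAlgHom.comp_apply, hfz, map_smul, hσz, smul_smul, pow_succ]
    obtain ⟨f, hf, hfz⟩ := hit K
    have : f.comp q = q := FreeSphere.hom_ext fun i => by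
      rw [StarAlgHom.comp_apply, hfz, hζ.pow_eq_one, one_smul]
    intro x
    obtain ⟨a, rfl⟩ := hq x
    rw [← hf]
    exact DFunLike.congr_fun this a
  have hfix : ∀ x ∈ eigen σ 1, ∀ y ∈ eigen σ 1, Commute x y := fun x hx y hy =>
    FreeSphere.commute_of_fixed hK hq hcomm hσz hζ hx hy
  -- By faithfulness, if `q p ≠ 0` then the average of `(q p)⋆ (q p)` is a nonzero fixed element,
  -- which some character detects.
  refine eq_zero_of_eigenProj_one (σ := σ) hK (by_contra fun h0 => ?_)
  obtain ⟨χ, hχ, hχ0⟩ := exists_isFixedCharacter hK hσ hfix (eigenProj_mem hσ (one_pow K) hK) h0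
  have hζ1 : ∀ e : ℕ, star (ζ ^ e) * ζ ^ e = 1 := fun e => by
    rw [Complex.star_def, ← Complex.normSq_eq_conj_mul_self, Complex.normSq_eq_norm_sq, norm_pow,
      hζ.norm'_eq_one hK, one_pow, one_pow, Complex.ofReal_one]
  have hV' : ∀ e : ℕ, coordSpan (fun i => star (q (FreeSphere.z i))) ^ e ≤ eigen σ (star (ζ ^ e)) :=
    fun e => by rw [star_pow]; exact pow_le_eigen (coordSpan_star_le_eigen hσz) e
  obtain ⟨n, rfl⟩ := Nat.exists_eq_succ_of_ne_zero hK
  -- The choice `b 0 = 1` makes the `(0, 0)` matrix entry of the representation equal to `χ` itself.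
  have hb : ∀ e : Fin (n + 1), ∃ b ∈ eigen σ (ζ ^ (e : ℕ)), χ (star b * b) = 1 ∧ (e = 0 → b = 1) :=
    fun e => by
      by_cases he : e = 0
      · subst he
        exact ⟨1, by rw [Fin.val_zero, pow_zero]; exact mem_eigen_one.2 (map_one σ),
          by rw [star_one, one_mul, hχ.apply_one], fun _ => rfl⟩
      · obtain ⟨b, hb, hb1⟩ := hχ.exists_unit hfix (hζ1 e) (hV' e)
          (pow_le_eigen (coordSpan_le_eigen hσz) e)
          (((FreeSphere.sphereRel_z N).map q).one_le_star e)
        exact ⟨b, hb, hb1, fun h => (he h).elim⟩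
  choose b hb hb1 hb0 using hb
  obtain ⟨ρ, hρ⟩ := hχ.exists_matrix_rep hfix hK hζ hσ hb hb1
  obtain ⟨x, hx, hxρ⟩ := exists_mem_modelSpace (q := q) ρ fun i r c hrc => by
    rw [hρ]
    -- The `(r, c)` entry of `z_i` is `χ` of an element of degree `c + 1 - r`, so it vanishes unless
    -- `r = c + 1` modulo `K`.
    refine hχ.eq_zero_of_mem_eigen (c := star (ζ ^ (r : ℕ)) * ζ * ζ ^ (c : ℕ)) (fun h => hrc ?_)
      (mul_mem_eigen (mul_mem_eigen (star_mem_eigen (hb r)) (mem_eigen.2 (hσz i))) (hb c))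
    have h2 : ζ ^ (r : ℕ) = ζ ^ ((c : ℕ) + 1) := by
      rw [← mul_one (ζ ^ (r : ℕ)), ← h, pow_succ]
      linear_combination (ζ * ζ ^ (c : ℕ)) * hζ1 r
    refine Fin.ext ?_
    rw [coe_finRotate]
    split_ifs with hc
    -- Wrap-around: for the last column `ζ ^ (c + 1) = 1`, which forces `r = 0`.
    · rw [hc, Fin.val_last, hζ.pow_eq_one] at h2
      exact hζ.pow_inj r.2 n.succ_pos (by rw [h2, pow_zero])
    · exact hζ.pow_inj r.2 (Nat.succ_lt_succ (Fin.val_lt_last hc)) h2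
  have hρp : ρ (q p) = 0 := CStarMatrix.ext fun r c => by
    rw [hxρ, hp x hx]
    rfl
  have h00 : ρ (star (q p) * q p) 0 0 = 0 := by
    rw [map_mul, hρp, mul_zero]
    rfl
  rw [hρ, hb0 0 rfl, star_one, one_mul, mul_one] at h00
  refine hχ0 ?_
  -- Since `χ` is invariant under `σ`, averaging does not change its value; so the nonzero value
  -- found above is the vanishing entry `h00`.
  have hav : ∀ y, χ (eigenProj σ (n + 1) 1 y) = χ y := fun y => by
    have hit : ∀ k : ℕ, χ (σ^[k] y) = χ y := fun k => by
      induction k with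
      | zero => rfl
      | succ k ih => rw [Function.iterate_succ_apply', hχ.apply_map, ih]
    have hn : ((n + 1 : ℕ) : ℂ) ≠ 0 := Nat.cast_ne_zero.2 hK
    rw [eigenProj_apply]
    simp only [inv_one, one_pow, one_smul, map_smul, map_sum, hit, Finset.sum_const,
      Finset.card_range, nsmul_eq_mul, smul_eq_mul]
    rw [inv_mul_cancel_left₀ hn]
  rw [hav, h00]

theorem theorem6p8 {N K : ℕ} (hK : 1 ≤ K) {A : Type*} [CStarAlgebra A]
    (q : FreeSphere N →⋆ₐ[ℂ] A) (hq : Function.Surjective q) (hsym : IsKSymmetric K q) :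
    (∃ T : Set (SpherePow N K), IsCompact T ∧ IsCyclicSymmetric T ∧
      ∃ π : (kClassIdeal K q).Quot →⋆ₐ[ℂ] Matrix (Fin K) (Fin K) C(T, ℂ),
        Function.Injective π) ∧
    SubspaceIncl (kClassIdeal K q) (repIdeal A K) := by
  have hK0 : K ≠ 0 := Nat.one_le_iff_ne_zero.1 hK
  set I := kClassIdeal K q with hI
  let Q : FreeSphere N →⋆ₐ[ℂ] I.Quot := I.quotMap.comp q
  have hQ : Function.Surjective Q := I.quotMap_surjective.comp hq
  have hcomm : ∀ a ∈ kCommutators K (fun i => Q (FreeSphere.z i)), a = 0 := by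
    have hmem : ∀ a ∈ kCommutators K (fun i => q (FreeSphere.z i)), I.quotMap a = 0 := fun a ha =>
      I.quotMap_eq_zero_iff.2 (ClosedIdeal.subset_span _ ha)
    rintro _ ⟨i, j, rfl | rfl⟩
    · have := hmem _ ⟨i, j, Or.inl rfl⟩
      rwa [map_sub, map_mul, map_mul, map_orderedProd, map_orderedProd] at this
    · have := hmem _ ⟨i, j, Or.inr rfl⟩
      rw [map_sub, map_mul, map_mul, map_orderedProd, map_orderedProd] at this
      simp only [map_star] at this
      exact this
  have hζ := Complex.isPrimitiveRoot_exp K hK0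
  obtain ⟨ω, hω⟩ : ∃ ω : rootsOfUnity K Circle,
      (((ω : Circleˣ) : Circle) : ℂ) = Complex.exp (2 * Real.pi * Complex.I / K) := by
    let u : Circle := ⟨_, mem_sphere_zero_iff_norm.2 (hζ.norm'_eq_one hK0)⟩
    have hu : u ^ K = 1 := Circle.ext (by rw [Circle.coe_pow]; exact hζ.pow_eq_one)
    have : NeZero K := ⟨hK0⟩
    exact ⟨rootsOfUnity.mkOfPowEq u hu, by rw [rootsOfUnity.val_mkOfPowEq_coe]⟩
  obtain ⟨σ, hσ⟩ := exists_rotation hsym ω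
  rw [hω] at hσ
  obtain ⟨π, hπ⟩ := exists_matrixModel (K := K) hQ
  have hinj : ∀ b, (∀ r c x, π b r c x = 0) → b = 0 := fun b hb => by
    obtain ⟨p, rfl⟩ := hQ b
    refine eq_zero_of_shiftModel hK0 hQ hcomm hζ hσ fun x hx r c => ?_
    rw [← hπ p r c ⟨x, hx⟩]
    exact hb r c ⟨x, hx⟩
  refine ⟨⟨modelSpace K Q, isCompact_modelSpace Q, isCyclicSymmetric_modelSpace Q, π, ?_⟩, ?_⟩
  · refine (injective_iff_map_eq_zero π).2 fun b hb => hinj b fun r c x => ?_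
    rw [hb]
    rfl
  -- Each point of the model space gives a `K`-dimensional representation of the quotient, hence of
  -- `C(X)`. It kills every `a ∈ J_K`, so the model sends the class of `a` to zero, and injectivity
  -- puts `a` in the ideal.
  · refine ClosedIdeal.subspaceIncl fun a ha => I.quotMap_eq_zero_iff.1 (hinj _ fun r c x => ?_)
    simp only [repIdeal, Submodule.mem_iInf, RingHom.mem_ker] at ha
    let e : CStarMatrix (Fin K) (Fin K) ℂ ≃⋆ₐ[ℂ] Matrix (Fin K) (Fin K) ℂ :=
      CStarMatrix.ofMatrixStarAlgEquiv.symm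
    obtain ⟨ρ, hρ⟩ := StarAlgHom.exists_factor hQ (e.toStarAlgHom.comp ((CStarMatrix.mapPerm
      (ContinuousMap.evalStarAlgHom ℂ ℂ x.1) (Equiv.refl _)).comp (shiftModel N K)))
      fun p hp => Matrix.ext fun r c => x.2 p hp r c
    obtain ⟨p, rfl⟩ := hq a
    change π (Q p) r c x = 0
    rw [hπ]
    have h := ha K le_rfl (ρ.comp I.quotMap)
    have h' : ρ (Q p) = 0 := h
    rw [hρ] at h'
    exact congrFun (congrFun h' r) c

end
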